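/- Let $q$ be a fixed prime power. For a real number $m$, call a polynomial in $\mathbb{F}_q[X]$ $m$-smooth if it has no irreducible factor of degree exceeding $m$. For positive reals $k,m$ and $F,a\in\mathbb{F}_q[X]$, let $\Psi^\#(k,m;F,a)$ be the number of square-free, $m$-smooth polynomials $g\in\mathbb{F}_q[X]$ with $g\equiv a \pmod F$ and $\deg g<k$. Fix real numbers $\beta\in(23/24,1]$ and $\alpha\in(9/2-3\beta,\,3\beta]$, and fix functions $\eta_1,\eta_2:\mathbb{N}\to\mathbb{R}$ with $\eta_1(r)\to0$ and $\eta_2(r)\to0$ as $r\to\infty$. Then there is a function $e:\mathbb{N}\to\mathbb{R}$ with $e(r)\to 0$ as $r\to\infty$ (depending only on $q,\alpha,\beta,\eta_1,\eta_2$) such that, for all sufficiently large $r$, for all reals $k,m$ with $$r\alpha\le k\le r(\alpha+\eta_1(r)),\qquad r\beta\le m\le r(\beta+\eta_2(r)),$$ for every monic irreducible $F\in\mathbb{F}_q[X]$ of degree $r$, and for every $a\in\mathbb{F}_q[X]$ (with $F\nmid a$ in the case $\beta<1$), one has $$\Psi^\#(k,m;F,a)\ \ge\ q^{\,k-r+e(r)\,r}.$$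 -/

import Mathlib

open Filter Topology Polynomial

/-- A polynomial is `m`-smooth, for a real number `m`, if it has no irreducible factor of
degree exceeding `m`. -/
def PolySmooth {K : Type*} [Field K] (m : ℝ) (g : K[X]) : Prop :=
  ∀ p : K[X], Irreducible p → p ∣ g → (p.natDegree : ℝ) ≤ m

/-- The set of all (not necessarily monic) square-free `m`-smooth polynomials `g` with
`g ≡ a mod F` and `deg g < k`. Square-freeness excludes `g = 0`, so `natDegree` is the degree. -/
def smoothSqfreeSet {K : Type*} [Field K] (k m : ℝ) (F a : K[X]) : Set K[X] :=
  {g : K[X] | F ∣ g - a ∧ (g.natDegree : ℝ) < k ∧ PolySmooth m g ∧ Squarefree g}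

/-- Over a finite field only finitely many polynomials are counted. -/
theorem smoothSqfreeSet_finite {K : Type*} [Field K] [Finite K] (k m : ℝ) (F a : K[X]) :
    (smoothSqfreeSet k m F a).Finite := by
  have hfin : Finite (Polynomial.degreeLT K ⌈k⌉₊) :=
    Finite.of_equiv _ (Polynomial.degreeLTEquiv K ⌈k⌉₊).toEquiv.symm
  refine (Set.toFinite (Polynomial.degreeLT K ⌈k⌉₊ : Set K[X])).subset ?_
  rintro g ⟨-, hk, -, hg⟩
  have h1 : g.natDegree < ⌈k⌉₊ := Nat.lt_ceil.2 hk
  exact Polynomial.mem_degreeLT.2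
    ((Polynomial.natDegree_lt_iff_degree_lt hg.ne_zero).1 h1)

/-- The counting function `Ψ^#(k, m; F, a)`. -/
noncomputable def PsiSharp {K : Type*} [Field K] (k m : ℝ) (F a : K[X]) : ℕ :=
  (smoothSqfreeSet k m F a).ncard

/-! Square-free smooth members of a residue class prime to `F` are found among products `u v v' w
w'`, with `deg u < N` and `v, v'` (degree `n`), `w, w'` (degree `e`) monic irreducible. Smoothness
is automatic when `N, n, e ≤ m`.

Fix `w, w'`. The congruence becomes `u ≡ c / (v v') mod F`, which asks a product of two inverses,
times `c`, to lie in the additive subgroup of residues of small-degree polynomials. Characters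
trivial on that subgroup turn the count into bilinear sums over inverses of irreducibles. Two
applications of Cauchy–Schwarz and a fourth moment bound these sums by the additive energies of the
two sets (`norm_bilinear_sum_pow_eight_le`). If `3 n < r`, clearing denominators in `1/v₁ - 1/v₂ =
1/v₃ - 1/v₄` gives a genuine polynomial identity, and unique factorization leaves only diagonal
solutions, so the energy is of minimal order.

Up to polynomial factors in `r`, the error per pair `(w, w')` is `q^(3n/2 + r/8)` against a main
term `q^(N + 2n - r)`, so `N + n/2` must exceed `9r/8`. With `N ≈ β r` this forces `n > (9/4 - 2β)
r`, compatible with `n < r/3` exactly when `β > 23/24`. Total degree about `α r` then leaves `2e ≈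
(α - 9/2 + 3β) r`, which explains the lower bound on `α`.

A sieve secures square-freeness. A repeated irreducible of degree below `D₀` can only come from `u`,
and the same count for multiples of `p²` removes at most `3/4` of the main term, up to error;
repeated factors of larger degree give few products (`card_image_le_of_large_square_factor`). A
product has polynomially many representations in `r`. When `β = 1` and `F ∣ a`, products `F w w'`
suffice. A diagonal choice of `ε` finally produces `e(r)`. -/

open Finset in
/-- The number of quadruples in `A` with `x₁ - x₂ = x₃ - x₄`. -/
def differenceEnergy {L : Type*} [AddGroup L] [DecidableEq L] (A : Finset L) : ℕ :=
  #{z ∈ (A ×ˢ A) ×ˢ (A ×ˢ A) | z.1.1 - z.1.2 = z.2.1 - z.2.2}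

/-! ### Bilinear character sums and additive energy. -/

section BilinearSums

variable {L : Type*} [Field L] [Fintype L]

theorem normSq_sum_addChar (ψ : AddChar L ℂ) (A : Finset L) (t : L) :
    ((‖∑ x ∈ A, ψ (x * t)‖ ^ 2 : ℝ) : ℂ) = ∑ z ∈ A ×ˢ A, ψ ((z.1 - z.2) * t) := by
  rw [Complex.ofReal_pow, ← Complex.mul_conj', map_sum, Finset.sum_mul_sum, Finset.sum_product]
  refine Finset.sum_congr rfl fun x _ => Finset.sum_congr rfl fun y _ => ?_
  rw [← AddChar.map_neg_eq_conj, ← AddChar.map_add_eq_mul]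
  ring_nf

variable [DecidableEq L]

/-- Orthogonality over `t`: the fourth power is a product of two squared moduli, each a sum over
differences. -/
theorem sum_norm_pow_four_sum_addChar {ψ : AddChar L ℂ} (hψ : ψ ≠ 1) (A : Finset L) :
    ∑ t, ‖∑ x ∈ A, ψ (x * t)‖ ^ 4 = Fintype.card L * differenceEnergy A := by
  have h : ∀ t, ((‖∑ x ∈ A, ψ (x * t)‖ ^ 4 : ℝ) : ℂ) =
      ∑ z ∈ (A ×ˢ A) ×ˢ (A ×ˢ A), ψ (t * ((z.1.1 - z.1.2) - (z.2.1 - z.2.2))) := by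
    intro t
    have h1 : ‖∑ x ∈ A, ψ (x * t)‖ ^ 4 = ‖∑ x ∈ A, ψ (x * t)‖ ^ 2 * ‖∑ x ∈ A, ψ (x * t)‖ ^ 2 := by
      ring
    -- The square is real, so it may be conjugated; the resulting sign puts the second difference in
    -- the form required by the energy.
    have h2 : ((‖∑ x ∈ A, ψ (x * t)‖ ^ 2 : ℝ) : ℂ) = ∑ z ∈ A ×ˢ A, ψ (-((z.1 - z.2) * t)) := by
      rw [← Complex.conj_ofReal, normSq_sum_addChar, map_sum]
      exact Finset.sum_congr rfl fun z _ => (AddChar.map_neg_eq_conj _ _).symm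
    rw [h1, Complex.ofReal_mul]
    nth_rewrite 2 [h2]
    rw [normSq_sum_addChar, Finset.sum_mul_sum, ← Finset.sum_product']
    refine Finset.sum_congr rfl fun z _ => ?_
    rw [← AddChar.map_add_eq_mul]
    ring_nf
  have key : ((∑ t, ‖∑ x ∈ A, ψ (x * t)‖ ^ 4 : ℝ) : ℂ)
      = ((Fintype.card L * differenceEnergy A : ℝ) : ℂ) := by
    rw [Complex.ofReal_sum, Finset.sum_congr rfl fun t _ => h t, Finset.sum_comm]
    simp_rw [AddChar.sum_mulShift _ (AddChar.IsPrimitive.of_ne_one hψ), sub_eq_zero]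
    rw [← Nat.cast_sum, ← Finset.sum_filter, Finset.sum_const, differenceEnergy]
    push_cast
    simp [mul_comm]
  exact_mod_cast key

/-- Group pairs of `B` by their difference `t` and apply Cauchy–Schwarz; the representation numbers
of `t` have square sum equal to the energy of `B`. -/
theorem sum_norm_sq_fiberwise (ψ : AddChar L ℂ) (A B : Finset L) :
    (∑ z ∈ B ×ˢ B, ‖∑ x ∈ A, ψ (x * (z.1 - z.2))‖ ^ 2) ^ 2 ≤
      differenceEnergy B * ∑ t, ‖∑ x ∈ A, ψ (x * t)‖ ^ 4 := by
  set f : L → ℝ := fun t => ‖∑ x ∈ A, ψ (x * t)‖ ^ 2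
  set R : L → ℝ := fun t => (((B ×ˢ B).filter fun z => z.1 - z.2 = t).card : ℝ)
  have h1 : ∑ z ∈ B ×ˢ B, f (z.1 - z.2) = ∑ t, R t * f t := by
    rw [← Finset.sum_fiberwise (B ×ˢ B) (fun z => z.1 - z.2)]
    refine Finset.sum_congr rfl fun t _ => ?_
    rw [Finset.sum_congr rfl (g := fun _ => f t)]
    · simp [R]
    · intro z hz
      rw [(Finset.mem_filter.1 hz).2]
  have h2 : ∑ t, R t ^ 2 = differenceEnergy B := by
    rw [differenceEnergy, Finset.card_eq_sum_card_fiberwise (f := fun z => z.1.1 - z.1.2)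
      (t := Finset.univ) (fun _ _ => Finset.mem_coe.2 (Finset.mem_univ _))]
    push_cast
    refine Finset.sum_congr rfl fun t _ => ?_
    simp only [R]
    rw [sq, ← Nat.cast_mul, ← Finset.card_product]
    congr 2
    ext ⟨⟨a, b⟩, c, d⟩
    simp only [Finset.mem_product, Finset.mem_filter]
    constructor
    · rintro ⟨⟨h, h'⟩, k, k'⟩
      exact ⟨⟨⟨h, k⟩, h'.trans k'.symm⟩, h'⟩
    · rintro ⟨⟨⟨h, k⟩, e⟩, h'⟩
      exact ⟨⟨h, h'⟩, k, e ▸ h'⟩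
  have h3 := Finset.sum_mul_sq_le_sq_mul_sq Finset.univ R f
  rw [h2] at h3
  rw [show ∑ z ∈ B ×ˢ B, ‖∑ x ∈ A, ψ (x * (z.1 - z.2))‖ ^ 2 = ∑ z ∈ B ×ˢ B, f (z.1 - z.2) from rfl,
    h1]
  refine h3.trans_eq ?_
  congr 1
  refine Finset.sum_congr rfl fun t _ => ?_
  simp only [f]
  ring

/-- A bilinear character sum is controlled by the additive energies of the two sets. -/
theorem norm_bilinear_sum_pow_eight_le {ψ : AddChar L ℂ} (hψ : ψ ≠ 1) (A B : Finset L) :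
    ‖∑ x ∈ A, ∑ y ∈ B, ψ (x * y)‖ ^ 8 ≤
      A.card ^ 4 * B.card ^ 4 * differenceEnergy A * differenceEnergy B * Fintype.card L := by
  set S := ‖∑ x ∈ A, ∑ y ∈ B, ψ (x * y)‖
  set T := ∑ z ∈ B ×ˢ B, ‖∑ x ∈ A, ψ (x * (z.1 - z.2))‖
  set V := ∑ z ∈ B ×ˢ B, ‖∑ x ∈ A, ψ (x * (z.1 - z.2))‖ ^ 2
  have hS0 : 0 ≤ S := norm_nonneg _
  have hT0 : 0 ≤ T := Finset.sum_nonneg fun _ _ => norm_nonneg _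
  have hV0 : 0 ≤ V := Finset.sum_nonneg fun _ _ => by positivity
  have h1 : S ^ 2 ≤ A.card * T := by
    have e1 : S ^ 2 ≤ A.card * ∑ x ∈ A, ‖∑ y ∈ B, ψ (y * x)‖ ^ 2 := by
      calc S ^ 2 ≤ (∑ x ∈ A, ‖∑ y ∈ B, ψ (x * y)‖) ^ 2 := by
            gcongr
            exact norm_sum_le _ _
        _ ≤ A.card * ∑ x ∈ A, ‖∑ y ∈ B, ψ (x * y)‖ ^ 2 := sq_sum_le_card_mul_sum_sq
        _ = _ := by simp_rw [mul_comm]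
    refine e1.trans ?_
    gcongr
    have e2 : ((∑ x ∈ A, ‖∑ y ∈ B, ψ (y * x)‖ ^ 2 : ℝ) : ℂ) =
        ∑ z ∈ B ×ˢ B, ∑ x ∈ A, ψ (x * (z.1 - z.2)) := by
      rw [Complex.ofReal_sum, Finset.sum_congr rfl fun x _ => normSq_sum_addChar ψ B x,
        Finset.sum_comm]
      simp_rw [mul_comm]
    calc ∑ x ∈ A, ‖∑ y ∈ B, ψ (y * x)‖ ^ 2
        = ‖((∑ x ∈ A, ‖∑ y ∈ B, ψ (y * x)‖ ^ 2 : ℝ) : ℂ)‖ := by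
          rw [Complex.norm_real, Real.norm_of_nonneg (Finset.sum_nonneg fun _ _ => by positivity)]
      _ ≤ T := by
          rw [e2]
          exact norm_sum_le _ _
  have h2 : T ^ 2 ≤ B.card ^ 2 * V := by
    have := sq_sum_le_card_mul_sum_sq (s := B ×ˢ B)
      (f := fun z => ‖∑ x ∈ A, ψ (x * (z.1 - z.2))‖)
    rw [Finset.card_product] at this
    push_cast at this
    rw [sq (B.card : ℝ)]
    exact this
  have h3 : V ^ 2 ≤ differenceEnergy B * (Fintype.card L * differenceEnergy A) :=
    (sum_norm_sq_fiberwise ψ A B).trans_eq (by rw [sum_norm_pow_four_sum_addChar hψ])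
  calc S ^ 8 = (S ^ 2) ^ 4 := by ring
    _ ≤ (A.card * T) ^ 4 := by gcongr
    _ = A.card ^ 4 * (T ^ 2) ^ 2 := by ring
    _ ≤ A.card ^ 4 * (B.card ^ 2 * V) ^ 2 := by gcongr
    _ = A.card ^ 4 * B.card ^ 4 * V ^ 2 := by ring
    _ ≤ A.card ^ 4 * B.card ^ 4 * (differenceEnergy B * (Fintype.card L * differenceEnergy A)) := by
        gcongr
    _ = _ := by ring

/-- The number of `(x, y) ∈ A × B` for which `c * (x * y)` lies in an additive subgroup `U` is close
to its expected value. -/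
theorem abs_card_bilinear_mem_addSubgroup_sub_le (A B : Finset L) (U : AddSubgroup L)
    [DecidablePred (· ∈ U)] {c : L} (hc : c ≠ 0) {S : ℝ} (hS0 : 0 ≤ S)
    (hS : (A.card : ℝ) ^ 4 * B.card ^ 4 * differenceEnergy A * differenceEnergy B * Fintype.card L
      ≤ S ^ 8) :
    |(((A ×ˢ B).filter fun z => c * (z.1 * z.2) ∈ U).card : ℝ) -
      Nat.card U * A.card * B.card / Fintype.card L| ≤ S := by
  classical
  let G := L ⧸ U
  have : Fintype G := Fintype.ofFinite G
  set N := ((A ×ˢ B).filter fun z => c * (z.1 * z.2) ∈ U).card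
  have hG : (0 : ℝ) < Fintype.card G := Nat.cast_pos.2 Fintype.card_pos
  have hcard : (Fintype.card L : ℝ) = Fintype.card G * Nat.card U := by
    have := AddSubgroup.card_eq_card_quotient_mul_card_addSubgroup U
    rw [Nat.card_eq_fintype_card, Nat.card_eq_fintype_card (α := L ⧸ U)] at this
    exact_mod_cast this
  have hU : (0 : ℝ) < Nat.card U := Nat.cast_pos.2 Nat.card_pos
  let mk : L →+ G := QuotientAddGroup.mk' U
  have hmk : Function.Surjective mk := QuotientAddGroup.mk'_surjective U
  -- Membership in `U` is detected by characters of the quotient `G`. There are `|G|` of them, which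
  -- cancels the normalization `1 / |G|`, so the error is a single bound `S`.
  let s : AddChar G ℂ → ℂ := fun χ => ∑ x ∈ A, ∑ y ∈ B, χ (mk (c * (x * y)))
  have hs : ∀ χ, χ ≠ 0 → ‖s χ‖ ≤ S := by
    intro χ hχ
    let ψ : AddChar L ℂ := χ.compAddMonoidHom (mk.comp (AddMonoidHom.mulLeft c))
    have hψ : ψ ≠ 1 := by
      obtain ⟨g, hg⟩ := AddChar.ne_zero_iff.1 hχ
      obtain ⟨l, rfl⟩ := hmk g
      refine AddChar.ne_one_iff.2 ⟨c⁻¹ * l, ?_⟩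
      simpa [ψ, hc] using hg
    have h := (norm_bilinear_sum_pow_eight_le hψ A B).trans hS
    exact le_of_pow_le_pow_left₀ (by norm_num) hS0 h
  have hsum : (N : ℂ) * Fintype.card G = ∑ χ, s χ := by
    simp only [s]
    rw [Finset.sum_comm]
    simp_rw [Finset.sum_comm (s := (Finset.univ : Finset (AddChar G ℂ))) (t := B),
      AddChar.sum_apply_eq_ite]
    rw [← Finset.sum_product', ← Finset.sum_filter, Finset.sum_const, nsmul_eq_mul]
    congr 2
    refine congrArg Finset.card (Finset.filter_congr fun z _ => ?_)
    exact (QuotientAddGroup.eq_zero_iff _).symm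
  have hs0 : s 0 = A.card * B.card := by simp [s]
  rw [← Finset.add_sum_erase _ _ (Finset.mem_univ (0 : AddChar G ℂ)), hs0] at hsum
  have hbound : |(N : ℝ) * Fintype.card G - A.card * B.card| ≤ Fintype.card G * S := by
    have h1 : (((N : ℝ) * Fintype.card G - A.card * B.card : ℝ) : ℂ) =
        ∑ χ ∈ Finset.univ.erase (0 : AddChar G ℂ), s χ := by
      push_cast
      rw [hsum]
      ring
    rw [← Real.norm_eq_abs, ← Complex.norm_real, h1]
    refine (norm_sum_le_of_le _ fun χ hχ => hs χ (Finset.ne_of_mem_erase hχ)).trans ?_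
    rw [Finset.sum_const, nsmul_eq_mul]
    gcongr
    refine (Finset.card_le_univ _).trans_eq ?_
    rw [AddChar.card_eq]
  have h2 : (Nat.card U * A.card * B.card / Fintype.card L : ℝ) =
      A.card * B.card / Fintype.card G := by
    rw [hcard]
    field_simp
  rw [h2, show (N : ℝ) - A.card * B.card / Fintype.card G =
    (N * Fintype.card G - A.card * B.card) / Fintype.card G by field_simp, abs_div,
    abs_of_pos hG, div_le_iff₀ hG, mul_comm S]
  exact hbound

end BilinearSums

/-! ### Counting polynomials and irreducibles over a finite field. -/

section PolynomialCounting

variable {K : Type*} [Field K]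

theorem natDegree_lt_of_mem_degreeLT {n : ℕ} {f : K[X]} (hf : f ∈ degreeLT K n) (h0 : f ≠ 0) :
    f.natDegree < n :=
  (natDegree_lt_iff_degree_lt h0).2 (mem_degreeLT.1 hf)

theorem mem_degreeLT_of_natDegree_lt {n : ℕ} {f : K[X]} (hf : f.natDegree < n) :
    f ∈ degreeLT K n := by
  rcases eq_or_ne f 0 with rfl | h0
  · exact zero_mem _
  · exact mem_degreeLT.2 ((natDegree_lt_iff_degree_lt h0).1 hf)

theorem mul_mem_degreeLT_iff {n d : ℕ} {f g : K[X]} (hf : f ≠ 0) (hd : f.natDegree = d)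
    (hdn : d ≤ n) : f * g ∈ degreeLT K n ↔ g ∈ degreeLT K (n - d) := by
  rcases eq_or_ne g 0 with rfl | hg
  · simp
  rw [mem_degreeLT, mem_degreeLT, ← natDegree_lt_iff_degree_lt (mul_ne_zero hf hg),
    ← natDegree_lt_iff_degree_lt hg, natDegree_mul hf hg, hd]
  omega

theorem eq_of_dvd_of_monic_irreducible {p q : K[X]} (hp : p.Monic) (hpi : Irreducible p)
    (hq : q.Monic) (hqi : Irreducible q) (h : p ∣ q) : p = q :=
  eq_of_monic_of_associated hp hq (hpi.associated_of_dvd hqi h)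

theorem isCoprime_of_monic_irreducible_ne {p q : K[X]} (hp : p.Monic) (hpi : Irreducible p)
    (hq : q.Monic) (hqi : Irreducible q) (h : p ≠ q) : IsCoprime p q :=
  (hpi.coprime_iff_not_dvd).2 fun h' => h (eq_of_dvd_of_monic_irreducible hp hpi hq hqi h')

theorem natDegree_prod_normalizedFactors_of_squarefree [DecidableEq K] {G : K[X]} (h0 : G ≠ 0)
    (hG : Squarefree G) :
    G.natDegree = ∑ p ∈ (UniqueFactorizationMonoid.normalizedFactors G).toFinset, p.natDegree := by
  have h1 := natDegree_eq_of_degree_eq (degree_eq_degree_of_associated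
    (UniqueFactorizationMonoid.prod_normalizedFactors h0))
  have hnd := (UniqueFactorizationMonoid.squarefree_iff_nodup_normalizedFactors h0).1 hG
  rw [← h1, natDegree_multiset_prod _ (UniqueFactorizationMonoid.zero_notMem_normalizedFactors G),
    Finset.sum, Multiset.toFinset_val, hnd.dedup]

variable [Fintype K]

instance (n : ℕ) : Finite (degreeLT K n) :=
  Finite.of_equiv _ (degreeLTEquiv K n).toEquiv.symm

variable (K) in
theorem natCard_degreeLT (n : ℕ) : Nat.card (degreeLT K n) = Fintype.card K ^ n := by
  rw [Nat.card_congr (degreeLTEquiv K n).toEquiv]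
  simp

theorem finite_coe_degreeLT (n : ℕ) : (degreeLT K n : Set K[X]).Finite :=
  inferInstanceAs (Finite (degreeLT K n))

variable (K) in
/-- The polynomials of degree less than `n` over a finite field. -/
noncomputable def polysLT (n : ℕ) : Finset K[X] := (finite_coe_degreeLT (K := K) n).toFinset

@[simp]
theorem mem_polysLT {n : ℕ} {f : K[X]} : f ∈ polysLT K n ↔ f ∈ degreeLT K n := by
  simp [polysLT]

theorem card_polysLT (n : ℕ) : (polysLT K n).card = Fintype.card K ^ n := by
  rw [← natCard_degreeLT, polysLT, ← Nat.card_eq_card_finite_toFinset]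
  rfl

-- Two solutions differ by a multiple of `F`. The subtraction is truncated: for `n ≤ deg F` the
-- bound reads 1.
open scoped Classical in
theorem card_filter_dvd_mul_sub_le {F c : K[X]} (hF : Irreducible F) (hc : ¬ F ∣ c) (a : K[X])
    (n : ℕ) : ((polysLT K n).filter fun h => F ∣ c * h - a).card ≤
      Fintype.card K ^ (n - F.natDegree) := by
  rcases ((polysLT K n).filter fun h => F ∣ c * h - a).eq_empty_or_nonempty with h | ⟨h₀, hh₀⟩
  · simp [h]
  rw [← card_polysLT]
  rw [Finset.mem_filter, mem_polysLT] at hh₀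
  have key : ∀ h ∈ (polysLT K n).filter fun h => F ∣ c * h - a, ∃ t, h - h₀ = F * t := by
    intro h hh
    rw [Finset.mem_filter] at hh
    have h1 : F ∣ c * (h - h₀) := by
      have := dvd_sub hh.2 hh₀.2
      rwa [show c * h - a - (c * h₀ - a) = c * (h - h₀) by ring] at this
    exact (hF.prime.dvd_or_dvd h1).resolve_left hc
  choose! t ht using key
  refine Finset.card_le_card_of_injOn t (fun h hh => ?_) fun h hh h' hh' e => ?_
  · have h1 : F * t h ∈ degreeLT K n := by
      rw [← ht h hh]
      exact sub_mem (mem_polysLT.1 (Finset.mem_filter.1 hh).1) hh₀.1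
    rw [Finset.mem_coe, mem_polysLT]
    rcases eq_or_ne (t h) 0 with h0 | h0
    · rw [h0]; exact zero_mem _
    · have h2 := natDegree_lt_of_mem_degreeLT h1 (mul_ne_zero hF.ne_zero h0)
      rw [natDegree_mul hF.ne_zero h0] at h2
      exact mem_degreeLT_of_natDegree_lt (by omega)
  · have h1 := ht h hh
    have h2 := ht h' hh'
    rw [e, ← h2] at h1
    exact sub_left_injective h1

theorem finite_monic_irreducible (n : ℕ) :
    {p : K[X] | p.Monic ∧ Irreducible p ∧ p.natDegree = n}.Finite :=
  (finite_coe_degreeLT (n + 1)).subset fun p hp => mem_degreeLT_of_natDegree_lt (by simp [hp.2.2])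

variable (K) in
/-- The monic irreducible polynomials of degree `n` over a finite field. -/
noncomputable def monicIrreducibles (n : ℕ) : Finset K[X] :=
  (finite_monic_irreducible (K := K) n).toFinset

@[simp]
theorem mem_monicIrreducibles {n : ℕ} {p : K[X]} :
    p ∈ monicIrreducibles K n ↔ p.Monic ∧ Irreducible p ∧ p.natDegree = n := by
  simp [monicIrreducibles]

theorem squarefree_X_pow_card_pow_sub_X {n : ℕ} (hn : n ≠ 0) :
    Squarefree (X ^ Fintype.card K ^ n - X : K[X]) := by
  obtain ⟨p, hp⟩ := CharP.exists K
  have hpd : p ∣ Fintype.card K ^ n :=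
    dvd_pow ((CharP.cast_eq_zero_iff K p _).1 (FiniteField.cast_card_eq_zero K)) hn
  exact (galois_poly_separable p _ hpd).squarefree

theorem X_pow_card_pow_sub_X_ne_zero' {n : ℕ} (hn : n ≠ 0) :
    (X ^ Fintype.card K ^ n - X : K[X]) ≠ 0 :=
  FiniteField.X_pow_card_pow_sub_X_ne_zero K hn Fintype.one_lt_card

/-- The irreducibles of degree `n` are pairwise coprime divisors of `X ^ q ^ n - X`; compare
degrees. -/
theorem mul_card_monicIrreducibles_le {n : ℕ} (hn : n ≠ 0) :
    n * (monicIrreducibles K n).card ≤ Fintype.card K ^ n := by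
  have h1 : ∏ p ∈ monicIrreducibles K n, p ∣ X ^ Fintype.card K ^ n - X := by
    refine Finset.prod_dvd_of_coprime (fun p hp q hq hpq => ?_) fun p hp => ?_
    · rw [Finset.mem_coe, mem_monicIrreducibles] at hp hq
      exact isCoprime_of_monic_irreducible_ne hp.1 hp.2.1 hq.1 hq.2.1 hpq
    · rw [mem_monicIrreducibles] at hp
      rw [← Nat.card_eq_fintype_card, ← hp.2.1.natDegree_dvd_iff_dvd_X_pow_card_pow_sub_X, hp.2.2]
  have h2 := natDegree_le_of_dvd h1 (X_pow_card_pow_sub_X_ne_zero' hn)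
  rw [FiniteField.X_pow_card_pow_sub_X_natDegree_eq K hn Fintype.one_lt_card,
    natDegree_prod_of_monic _ _ fun p hp => (mem_monicIrreducibles.1 hp).1,
    Finset.sum_congr rfl fun p hp => (mem_monicIrreducibles.1 hp).2.2, Finset.sum_const,
    smul_eq_mul, mul_comm] at h2
  exact h2

theorem mem_monicIrreducibles_of_mem_normalizedFactors [DecidableEq K] {G p : K[X]}
    (hp : p ∈ UniqueFactorizationMonoid.normalizedFactors G) :
    p ∈ monicIrreducibles K p.natDegree := by
  have hi := UniqueFactorizationMonoid.irreducible_of_normalized_factor p hp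
  refine mem_monicIrreducibles.2 ⟨?_, hi, rfl⟩
  rw [← UniqueFactorizationMonoid.normalize_normalized_factor p hp]
  exact monic_normalize hi.ne_zero

theorem card_pow_le_sum_mul_card_monicIrreducibles {n : ℕ} (hn : n ≠ 0) :
    Fintype.card K ^ n ≤ ∑ d ∈ n.divisors, d * (monicIrreducibles K d).card := by
  classical
  set G : K[X] := X ^ Fintype.card K ^ n - X
  have h0 : G ≠ 0 := X_pow_card_pow_sub_X_ne_zero' hn
  set s := (UniqueFactorizationMonoid.normalizedFactors G).toFinset
  have hs : ∀ p ∈ s, p.natDegree ∈ n.divisors := by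
    intro p hp
    rw [Multiset.mem_toFinset] at hp
    rw [Nat.mem_divisors]
    refine ⟨?_, hn⟩
    rw [(UniqueFactorizationMonoid.irreducible_of_normalized_factor p hp
      ).natDegree_dvd_iff_dvd_X_pow_card_pow_sub_X, Nat.card_eq_fintype_card]
    exact UniqueFactorizationMonoid.dvd_of_mem_normalizedFactors hp
  calc Fintype.card K ^ n = G.natDegree :=
        (FiniteField.X_pow_card_pow_sub_X_natDegree_eq K hn Fintype.one_lt_card).symm
    _ = ∑ p ∈ s, p.natDegree := natDegree_prod_normalizedFactors_of_squarefree h0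
        (squarefree_X_pow_card_pow_sub_X hn)
    _ = ∑ d ∈ n.divisors, ∑ p ∈ s with p.natDegree = d, p.natDegree :=
        (Finset.sum_fiberwise_of_maps_to hs _).symm
    _ ≤ _ := by
        refine Finset.sum_le_sum fun d _ => ?_
        rw [Finset.sum_congr rfl (g := fun _ => d) fun p hp => (Finset.mem_filter.1 hp).2,
          Finset.sum_const, smul_eq_mul, mul_comm]
        refine Nat.mul_le_mul_left _ (Finset.card_le_card fun p hp => ?_)
        obtain ⟨hps, rfl⟩ := Finset.mem_filter.1 hp
        exact mem_monicIrreducibles_of_mem_normalizedFactors (Multiset.mem_toFinset.1 hps)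

theorem sum_pow_Icc_one_add_two_le {q : ℕ} (hq : 2 ≤ q) (h : ℕ) :
    ∑ d ∈ Finset.Icc 1 h, q ^ d + 2 ≤ 2 * q ^ h := by
  induction h with
  | zero => simp
  | succ h ih =>
    rw [Finset.sum_Icc_succ_top (by omega), pow_succ]
    have := Nat.mul_le_mul_left (q ^ h) hq
    omega

/-- Proper divisors of `n` are at most `n / 2`, so with `x = q ^ (n / 2)` they contribute at most
`2x - 2 ≤ x² / 2 ≤ q ^ n / 2` to the degree of `X ^ q ^ n - X`. -/
theorem card_pow_le_two_mul_card_monicIrreducibles {n : ℕ} (hn : n ≠ 0) :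
    Fintype.card K ^ n ≤ 2 * n * (monicIrreducibles K n).card := by
  set q := Fintype.card K
  have hq : 2 ≤ q := Fintype.one_lt_card
  have h1 := card_pow_le_sum_mul_card_monicIrreducibles (K := K) hn
  rw [← Nat.cons_self_properDivisors hn, Finset.sum_cons] at h1
  have h2 : ∑ d ∈ n.properDivisors, d * (monicIrreducibles K d).card ≤
      ∑ d ∈ Finset.Icc 1 (n / 2), q ^ d := by
    refine (Finset.sum_le_sum fun d hd => mul_card_monicIrreducibles_le
      (Nat.pos_of_mem_properDivisors hd).ne').trans
        (Finset.sum_le_sum_of_subset fun d hd => ?_)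
    have hd1 := Nat.mem_properDivisors.1 hd
    have hd2 := Nat.pos_of_mem_properDivisors hd
    obtain ⟨c, rfl⟩ := hd1.1
    have hc : 2 ≤ c := by
      by_contra hc
      interval_cases c <;> simp_all
    rw [Finset.mem_Icc, Nat.le_div_iff_mul_le (by norm_num)]
    exact ⟨hd2, Nat.mul_le_mul_left _ hc⟩
  have h3 := sum_pow_Icc_one_add_two_le hq (n / 2)
  have h4 : q ^ (n / 2) * q ^ (n / 2) ≤ q ^ n := by
    rw [← pow_add]
    exact Nat.pow_le_pow_right (by omega) (by omega)
  have h5 : 4 * q ^ (n / 2) ≤ q ^ (n / 2) * q ^ (n / 2) + 4 := by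
    zify
    nlinarith [sq_nonneg ((q : ℤ) ^ (n / 2) - 2)]
  nlinarith

theorem card_monicIrreducibles_le (n : ℕ) :
    (monicIrreducibles K n).card ≤ Fintype.card K ^ n := by
  rcases eq_or_ne n 0 with rfl | hn
  · rw [Finset.card_eq_zero.2]
    · simp
    · rw [Finset.eq_empty_iff_forall_notMem]
      intro p hp
      rw [mem_monicIrreducibles] at hp
      exact hp.2.1.natDegree_pos.ne' hp.2.2
  · exact (Nat.le_mul_of_pos_left _ (Nat.pos_of_ne_zero hn)).trans (mul_card_monicIrreducibles_le hn)

-- Bounds the density of `u` divisible by the square of an irreducible. The sum is at most `∑ 1 / (d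
-- 2 ^ d)`; what matters is a constant below 1.
variable (K) in
theorem sum_card_monicIrreducibles_div_sq_le (n : ℕ) :
    ∑ d ∈ Finset.Ico 1 n, (monicIrreducibles K d).card / ((Fintype.card K : ℝ) ^ d) ^ 2 ≤ 3 / 4 := by
  have hq : (2 : ℝ) ≤ Fintype.card K := by exact_mod_cast Fintype.one_lt_card
  set q : ℝ := (Fintype.card K : ℝ)
  have hterm : ∀ d ≠ 0, (monicIrreducibles K d).card / (q ^ d) ^ 2 ≤ 1 / d * (1 / 2) ^ d := by
    intro d hd
    have h1 : (d : ℝ) * (monicIrreducibles K d).card ≤ q ^ d := by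
      simp only [q]
      exact_mod_cast mul_card_monicIrreducibles_le (K := K) hd
    have hd0 : (0 : ℝ) < d := Nat.cast_pos.2 (Nat.pos_of_ne_zero hd)
    have h2 : (2 : ℝ) ^ d ≤ q ^ d := pow_le_pow_left₀ (by norm_num) hq d
    have hq0 : (0 : ℝ) < q ^ d := by positivity
    calc (monicIrreducibles K d).card / (q ^ d) ^ 2
        ≤ (q ^ d / d) / (q ^ d) ^ 2 := by
          gcongr
          rw [le_div_iff₀ hd0]
          linarith
      _ = 1 / d * (1 / q ^ d) := by field_simp
      _ ≤ 1 / d * (1 / 2 ^ d) := by gcongr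
      _ = _ := by rw [one_div_pow]
  -- The term `d = 1` gives `1/2 = 3/4 - 1/4`; for `d ≥ 2` each term is at most `(1/2) ^ (d + 1)`,
  -- so the bound telescopes.
  have main : ∀ n, 2 ≤ n → ∑ d ∈ Finset.Ico 1 n, (monicIrreducibles K d).card / (q ^ d) ^ 2 ≤
      3 / 4 - (1 / 2) ^ n := by
    intro n hn
    induction n, hn using Nat.le_induction with
    | base =>
      have := hterm 1 one_ne_zero
      norm_num at this ⊢
      linarith
    | succ n hn ih =>
      rw [Finset.sum_Ico_succ_top (by omega)]
      have h1 := hterm n (by omega)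
      have h2 : (1 : ℝ) / n ≤ 1 / 2 := by
        have : (2 : ℝ) ≤ n := by exact_mod_cast hn
        gcongr
      have h3 : (0 : ℝ) < (1 / 2) ^ n := by positivity
      rw [pow_succ (1 / 2 : ℝ)]
      nlinarith
  rcases lt_or_ge n 2 with hn | hn
  · rw [Finset.Ico_eq_empty (by omega)]
    norm_num
  · have := main n hn
    have h3 : (0 : ℝ) < (1 / 2) ^ n := by positivity
    linarith

end PolynomialCounting

/-! ### Additive energy of inverses of irreducibles modulo `F`. -/

theorem differenceEnergy_le_of_trivial {L : Type*} [AddCommGroup L] [DecidableEq L] {A : Finset L}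
    (h : ∀ x₁ ∈ A, ∀ x₂ ∈ A, ∀ x₃ ∈ A, ∀ x₄ ∈ A, x₁ - x₂ = x₃ - x₄ →
      x₁ = x₂ ∨ x₁ = x₃ ∨ x₁ = x₄) :
    differenceEnergy A ≤ 3 * A.card ^ 2 := by
  have hsub : ((A ×ˢ A) ×ˢ (A ×ˢ A)).filter (fun z => z.1.1 - z.1.2 = z.2.1 - z.2.2) ⊆
      ((A ×ˢ A).image fun p => ((p.1, p.1), (p.2, p.2))) ∪
      (((A ×ˢ A).image fun p => ((p.1, p.2), (p.1, p.2))) ∪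
      ((A ×ˢ A).image fun p => ((p.1, p.2), (p.1 - p.2 + p.1, p.1)))) := by
    rintro ⟨⟨x₁, x₂⟩, x₃, x₄⟩ hz
    simp only [Finset.mem_filter, Finset.mem_product] at hz
    obtain ⟨⟨⟨h1, h2⟩, h3, h4⟩, he⟩ := hz
    simp only [Finset.mem_union, Finset.mem_image, Finset.mem_product, Prod.exists,
      Prod.mk.injEq]
    rcases h x₁ h1 x₂ h2 x₃ h3 x₄ h4 he with rfl | rfl | rfl
    · refine Or.inl ⟨x₁, x₃, ⟨h1, h3⟩, ⟨rfl, rfl⟩, rfl, ?_⟩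
      rwa [sub_self, eq_comm, sub_eq_zero] at he
    · exact Or.inr (Or.inl ⟨x₁, x₂, ⟨h1, h2⟩, ⟨rfl, rfl⟩, rfl, sub_right_injective he⟩)
    · exact Or.inr (Or.inr ⟨x₁, x₂, ⟨h1, h2⟩, ⟨rfl, rfl⟩, by rw [he, sub_add_cancel], rfl⟩)
  have hc : (A ×ˢ A).card = A.card ^ 2 := by rw [Finset.card_product, sq]
  refine (Finset.card_le_card hsub).trans ((Finset.card_union_le _ _).trans ?_)
  have h1 := Finset.card_image_le (s := A ×ˢ A) (f := fun p => ((p.1, p.1), (p.2, p.2)))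
  have h2 := (Finset.card_union_le _ _).trans (Nat.add_le_add
    (Finset.card_image_le (s := A ×ˢ A) (f := fun p => ((p.1, p.2), (p.1, p.2))))
    (Finset.card_image_le (s := A ×ˢ A) (f := fun p => ((p.1, p.2), (p.1 - p.2 + p.1, p.1)))))
  rw [hc] at h1 h2
  omega

section ResidueField

variable {K : Type*} [Field K] {F : K[X]}

theorem eq_of_mk_eq_of_natDegree_lt {u v : K[X]} (h : AdjoinRoot.mk F u = AdjoinRoot.mk F v)
    (hu : u.natDegree < F.natDegree) (hv : v.natDegree < F.natDegree) : u = v := by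
  by_contra hne
  have h1 := natDegree_le_of_dvd (AdjoinRoot.mk_eq_mk.1 h) (sub_ne_zero.2 hne)
  have h2 := natDegree_sub_le u v
  have := max_lt hu hv
  omega

theorem mk_ne_zero_of_natDegree_lt {v : K[X]} (hv0 : v ≠ 0) (hv : v.natDegree < F.natDegree) :
    AdjoinRoot.mk F v ≠ 0 := fun h =>
  hv0 (eq_of_mk_eq_of_natDegree_lt (by rw [h, map_zero]) hv (by simpa using by omega))

theorem natDegree_lt_of_mem_degreeLT_of_le {N r : ℕ} {u : K[X]} (hr : 0 < r) (hN : N ≤ r)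
    (hu : u ∈ degreeLT K N) : u.natDegree < r := by
  rcases eq_or_ne u 0 with rfl | h0
  · simpa using hr
  · exact (natDegree_lt_of_mem_degreeLT hu h0).trans_le hN

variable [Fintype K]

open scoped Classical in
variable (F) in
/-- The inverses modulo `F` of the monic irreducible polynomials of degree `n`. -/
noncomputable def irreducibleInverses [Fact (Irreducible F)] (n : ℕ) : Finset (AdjoinRoot F) :=
  (monicIrreducibles K n).image fun v => (AdjoinRoot.mk F v)⁻¹

variable [hF : Fact (Irreducible F)]

omit [Fintype K] in
theorem inv_mk_inj {u v : K[X]} (h : (AdjoinRoot.mk F u)⁻¹ = (AdjoinRoot.mk F v)⁻¹)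
    (hu : u.natDegree < F.natDegree) (hv : v.natDegree < F.natDegree) : u = v :=
  eq_of_mk_eq_of_natDegree_lt (inv_injective h) hu hv

theorem card_irreducibleInverses {n : ℕ} (hn : n < F.natDegree) :
    (irreducibleInverses F n).card = (monicIrreducibles K n).card := by
  refine Finset.card_image_of_injOn fun u hu v hv h => ?_
  rw [Finset.mem_coe, mem_monicIrreducibles] at hu hv
  exact inv_mk_inj h (by omega) (by omega)

/-- After clearing denominators both sides have degree at most `3n < deg F`, so the congruence is an
equality of polynomials; then the irreducible `v₁` must divide `v₂`, `v₃` or `v₄`. -/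
theorem differenceEnergy_irreducibleInverses_le [DecidableEq (AdjoinRoot F)] {n : ℕ}
    (hn : 3 * n < F.natDegree) :
    differenceEnergy (irreducibleInverses F n) ≤ 3 * (monicIrreducibles K n).card ^ 2 := by
  rw [← card_irreducibleInverses (F := F) (n := n) (by omega)]
  refine differenceEnergy_le_of_trivial ?_
  simp only [irreducibleInverses, Finset.forall_mem_image]
  intro v₁ h1 v₂ h2 v₃ h3 v₄ h4 he
  rw [mem_monicIrreducibles] at h1 h2 h3 h4
  have e1 := mk_ne_zero_of_natDegree_lt (F := F) h1.2.1.ne_zero (by omega)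
  have e2 := mk_ne_zero_of_natDegree_lt (F := F) h2.2.1.ne_zero (by omega)
  have e3 := mk_ne_zero_of_natDegree_lt (F := F) h3.2.1.ne_zero (by omega)
  have e4 := mk_ne_zero_of_natDegree_lt (F := F) h4.2.1.ne_zero (by omega)
  have key : (v₂ - v₁) * (v₃ * v₄) = (v₄ - v₃) * (v₁ * v₂) := by
    have hd : ∀ a b c d : K[X], a.natDegree = n → b.natDegree = n → c.natDegree = n →
        d.natDegree = n → ((a - b) * (c * d)).natDegree < F.natDegree := by
      intro a b c d ha hb hc hd
      have i1 := natDegree_mul_le (p := a - b) (q := c * d)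
      have i2 := natDegree_mul_le (p := c) (q := d)
      have i3 := natDegree_sub_le a b
      rw [ha, hb, max_self] at i3
      omega
    refine eq_of_mk_eq_of_natDegree_lt (F := F) ?_ (hd _ _ _ _ h2.2.2 h1.2.2 h3.2.2 h4.2.2)
      (hd _ _ _ _ h4.2.2 h3.2.2 h1.2.2 h2.2.2)
    rw [inv_sub_inv e1 e2, inv_sub_inv e3 e4, div_eq_div_iff (mul_ne_zero e1 e2)
      (mul_ne_zero e3 e4)] at he
    simpa using he
  have hdvd : v₁ ∣ (v₂ - v₁) * (v₃ * v₄) := key ▸ ⟨(v₄ - v₃) * v₂, by ring⟩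
  have hp := h1.2.1.prime
  rcases hp.dvd_or_dvd hdvd with h | h
  · have := eq_of_dvd_of_monic_irreducible h1.1 h1.2.1 h2.1 h2.2.1 ((dvd_sub_self_right).1 h)
    exact Or.inl (by rw [this])
  rcases hp.dvd_or_dvd h with h | h
  · have := eq_of_dvd_of_monic_irreducible h1.1 h1.2.1 h3.1 h3.2.1 h
    exact Or.inr (Or.inl (by rw [this]))
  · have := eq_of_dvd_of_monic_irreducible h1.1 h1.2.1 h4.1 h4.2.1 h
    exact Or.inr (Or.inr (by rw [this]))

end ResidueField

/-! ### Equidistribution of triple products modulo `F`. -/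

open scoped Classical in
/-- The number of solutions of `u * v * v' ≡ c` modulo `F`, with `u` a multiple of `f` of degree less
than `N` and `v`, `v'` monic irreducible of degrees `n`, `n'`, is close to its expected value. -/
theorem abs_card_triples_sub_le {K : Type*} [Field K] [Fintype K] {F : K[X]} (hF : Irreducible F)
    {n n' N : ℕ} (hn : 3 * n < F.natDegree) (hn' : 3 * n' < F.natDegree) (hN : N ≤ F.natDegree)
    {f : K[X]} (hf0 : f ≠ 0) (hfN : f.natDegree ≤ N) {c : K[X]} (hc : ¬ F ∣ c) {S : ℝ}
    (hS0 : 0 ≤ S) (hS : 9 * (monicIrreducibles K n).card ^ 6 * (monicIrreducibles K n').card ^ 6 *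
      (Fintype.card K : ℝ) ^ F.natDegree ≤ S ^ 8) :
    |(((polysLT K N ×ˢ (monicIrreducibles K n ×ˢ monicIrreducibles K n')).filter
        fun t => f ∣ t.1 ∧ F ∣ t.1 * (t.2.1 * t.2.2) - c).card : ℝ) -
      (Fintype.card K : ℝ) ^ (N - f.natDegree) * (monicIrreducibles K n).card *
        (monicIrreducibles K n').card / (Fintype.card K : ℝ) ^ F.natDegree| ≤ S := by
  have : Fact (Irreducible F) := ⟨hF⟩
  have hr : 0 < F.natDegree := hF.natDegree_pos
  have : Module.Finite K (AdjoinRoot F) := (AdjoinRoot.powerBasis hF.ne_zero).finite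
  have : Finite (AdjoinRoot F) := Module.finite_of_finite K
  have : Fintype (AdjoinRoot F) := Fintype.ofFinite _
  have hcard : Fintype.card (AdjoinRoot F) = Fintype.card K ^ F.natDegree := by
    rw [← Nat.card_eq_fintype_card, Module.natCard_eq_pow_finrank (K := K),
      Nat.card_eq_fintype_card, (AdjoinRoot.powerBasis hF.ne_zero).finrank,
      AdjoinRoot.powerBasis_dim]
  set mk := AdjoinRoot.mk F
  set A := irreducibleInverses F n
  set B := irreducibleInverses F n'
  have hA : A.card = (monicIrreducibles K n).card := card_irreducibleInverses (by omega)
  have hB : B.card = (monicIrreducibles K n').card := card_irreducibleInverses (by omega)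
  set U : AddSubgroup (AdjoinRoot F) := (degreeLT K (N - f.natDegree)).toAddSubgroup.map
    (mk.toAddMonoidHom.comp (AddMonoidHom.mulLeft f))
  have hUmem : ∀ x, x ∈ U ↔ ∃ t ∈ degreeLT K (N - f.natDegree), mk (f * t) = x := by
    intro x
    simp [U, AddSubgroup.mem_map]
  have hUcard : Nat.card U = Fintype.card K ^ (N - f.natDegree) := by
    rw [← natCard_degreeLT]
    refine Nat.card_image_of_injOn fun s hs t ht h => ?_
    have hs' := (mul_mem_degreeLT_iff hf0 rfl hfN).2 hs
    have ht' := (mul_mem_degreeLT_iff hf0 rfl hfN).2 ht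
    exact mul_left_cancel₀ hf0 (eq_of_mk_eq_of_natDegree_lt h
      (natDegree_lt_of_mem_degreeLT_of_le hr hN hs') (natDegree_lt_of_mem_degreeLT_of_le hr hN ht'))
  have hmkc : mk c ≠ 0 := fun h => hc (AdjoinRoot.mk_eq_zero.1 h)
  have hEA : (differenceEnergy A : ℝ) ≤ 3 * A.card ^ 2 := by
    rw [hA]
    exact_mod_cast differenceEnergy_irreducibleInverses_le hn
  have hEB : (differenceEnergy B : ℝ) ≤ 3 * B.card ^ 2 := by
    rw [hB]
    exact_mod_cast differenceEnergy_irreducibleInverses_le hn'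
  have main := abs_card_bilinear_mem_addSubgroup_sub_le A B U hmkc hS0 (by
    rw [← hA, ← hB] at hS
    refine le_trans ?_ hS
    rw [hcard]
    push_cast
    calc _ ≤ (A.card : ℝ) ^ 4 * B.card ^ 4 * (3 * A.card ^ 2) * (3 * B.card ^ 2) *
          (Fintype.card K : ℝ) ^ F.natDegree := by gcongr
      _ = _ := by ring)
  rw [hUcard, hcard, hA, hB] at main
  push_cast at main
  -- Triples correspond to pairs of inverses: since `N ≤ deg F`, the residue `c / (v v')` determines
  -- `u`.
  convert main using 4
  refine Finset.card_bij (fun t _ => ((mk t.2.1)⁻¹, (mk t.2.2)⁻¹)) ?_ ?_ ?_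
  · rintro ⟨u, v, v'⟩ ht
    simp only [Finset.mem_filter, Finset.mem_product, mem_polysLT] at ht
    obtain ⟨⟨hu, hv, hv'⟩, ⟨t, rfl⟩, hd⟩ := ht
    have hv1 := mem_monicIrreducibles.1 hv
    have hv1' := mem_monicIrreducibles.1 hv'
    have e1 : mk v ≠ 0 := mk_ne_zero_of_natDegree_lt hv1.2.1.ne_zero (by omega)
    have e1' : mk v' ≠ 0 := mk_ne_zero_of_natDegree_lt hv1'.2.1.ne_zero (by omega)
    simp only [Finset.mem_filter, Finset.mem_product]
    refine ⟨⟨Finset.mem_image_of_mem _ hv, Finset.mem_image_of_mem _ hv'⟩, (hUmem _).2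
      ⟨t, (mul_mem_degreeLT_iff hf0 rfl hfN).1 hu, ?_⟩⟩
    rw [← AdjoinRoot.mk_eq_mk.2 hd, map_mul _ (f * t), map_mul _ v]
    field_simp
    rfl
  · rintro ⟨u, v, w⟩ ht ⟨u', v', w'⟩ ht' he
    simp only [Finset.mem_filter, Finset.mem_product, mem_polysLT, mem_monicIrreducibles]
      at ht ht'
    obtain ⟨⟨hu, hv, hw⟩, -, hd⟩ := ht
    obtain ⟨⟨hu', hv', hw'⟩, -, hd'⟩ := ht'
    simp only [Prod.mk.injEq] at he
    obtain rfl := inv_mk_inj he.1 (by omega) (by omega)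
    obtain rfl := inv_mk_inj he.2 (by omega) (by omega)
    have e1 : mk v ≠ 0 := mk_ne_zero_of_natDegree_lt hv.2.1.ne_zero (by omega)
    have e2 : mk w ≠ 0 := mk_ne_zero_of_natDegree_lt hw.2.1.ne_zero (by omega)
    have h1 : mk u = mk u' := by
      have h2 := (AdjoinRoot.mk_eq_mk.2 hd).trans (AdjoinRoot.mk_eq_mk.2 hd').symm
      rw [map_mul, map_mul _ u'] at h2
      exact mul_right_cancel₀ (by rw [map_mul]; exact mul_ne_zero e1 e2) h2
    rw [eq_of_mk_eq_of_natDegree_lt h1 (natDegree_lt_of_mem_degreeLT_of_le hr hN hu)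
      (natDegree_lt_of_mem_degreeLT_of_le hr hN hu')]
  · rintro ⟨x, y⟩ hz
    simp only [Finset.mem_filter, Finset.mem_product] at hz
    obtain ⟨⟨hx, hy⟩, hU⟩ := hz
    obtain ⟨v, hv, rfl⟩ := Finset.mem_image.1 hx
    obtain ⟨w, hw, rfl⟩ := Finset.mem_image.1 hy
    obtain ⟨t, ht, hte⟩ := (hUmem _).1 hU
    have hv1 := mem_monicIrreducibles.1 hv
    have hw1 := mem_monicIrreducibles.1 hw
    have e1 : mk v ≠ 0 := mk_ne_zero_of_natDegree_lt hv1.2.1.ne_zero (by omega)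
    have e2 : mk w ≠ 0 := mk_ne_zero_of_natDegree_lt hw1.2.1.ne_zero (by omega)
    refine ⟨(f * t, v, w), ?_, rfl⟩
    simp only [Finset.mem_filter, Finset.mem_product, mem_polysLT]
    refine ⟨⟨(mul_mem_degreeLT_iff hf0 rfl hfN).2 ht, hv, hw⟩, dvd_mul_right _ _,
      AdjoinRoot.mk_eq_mk.1 ?_⟩
    change mk _ = mk c
    rw [map_mul _ (f * t), hte, map_mul]
    change mk c * ((mk v)⁻¹ * (mk w)⁻¹) * _ = _
    field_simp

/-! ### Products of five factors and the square-free sieve. -/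

section ProductTuples

open scoped Classical

variable {K : Type*} [Field K] [Fintype K]

/-- Tuples `(u, (v, v'), (w, w'))` with `deg u < N`, with `v`, `v'` monic irreducible of degree `n`
and `w`, `w'` monic irreducible of degree `e`, whose product is `a` modulo `F`. -/
noncomputable def productTuples (F a : K[X]) (N n e : ℕ) :
    Finset (K[X] × (K[X] × K[X]) × (K[X] × K[X])) :=
  (polysLT K N ×ˢ ((monicIrreducibles K n ×ˢ monicIrreducibles K n) ×ˢ
    (monicIrreducibles K e ×ˢ monicIrreducibles K e))).filter
    fun t => F ∣ t.1 * (t.2.1.1 * t.2.1.2) * (t.2.2.1 * t.2.2.2) - a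

/-- The product of the entries of a tuple. -/
noncomputable def tupleProduct (t : K[X] × (K[X] × K[X]) × (K[X] × K[X])) : K[X] :=
  t.1 * (t.2.1.1 * t.2.1.2) * (t.2.2.1 * t.2.2.2)

variable {F a : K[X]} {N n e : ℕ}

theorem mem_productTuples {t : K[X] × (K[X] × K[X]) × (K[X] × K[X])} :
    t ∈ productTuples F a N n e ↔ (t.1 ∈ polysLT K N ∧ (t.2.1.1 ∈ monicIrreducibles K n ∧
      t.2.1.2 ∈ monicIrreducibles K n) ∧ t.2.2.1 ∈ monicIrreducibles K e ∧
      t.2.2.2 ∈ monicIrreducibles K e) ∧ F ∣ tupleProduct t - a := by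
  simp only [productTuples, tupleProduct, Finset.mem_filter, Finset.mem_product]

omit [Fintype K] in
theorem exists_mul_sub_dvd (hF : Irreducible F) {w : K[X]} (hw : ¬ F ∣ w) (ha : ¬ F ∣ a) :
    ∃ c, ¬ F ∣ c ∧ ∀ x, F ∣ x * w - a ↔ F ∣ x - c := by
  obtain ⟨s, t, h⟩ := (hF.coprime_iff_not_dvd).2 hw
  have h1 : F ∣ a * t * w - a := ⟨-(a * s), by linear_combination a * h⟩
  refine ⟨a * t, fun h2 => ha ?_, fun x => ⟨fun h2 => ?_, fun h2 => ?_⟩⟩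
  · have := dvd_sub (h2.mul_right w) h1
    rwa [sub_sub_cancel] at this
  · have h3 := dvd_sub h2 h1
    rw [show x * w - a - (a * t * w - a) = (x - a * t) * w by ring] at h3
    exact (hF.prime.dvd_or_dvd h3).resolve_right hw
  · have h3 := dvd_add (h2.mul_right w) h1
    rwa [show (x - a * t) * w + (a * t * w - a) = x * w - a by ring] at h3

/-- For each fixed `(w, w')`, invertible modulo `F` because `e < deg F`, this is the triple count
for another nonzero class. Taking `f = 1` gives the main term, and `f = p²` feeds the sieve. -/
theorem abs_card_filter_dvd_productTuples_sub_le (hF : Irreducible F) (ha : ¬ F ∣ a)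
    (hn : 3 * n < F.natDegree) (he : e < F.natDegree) (hN : N ≤ F.natDegree)
    {f : K[X]} (hf0 : f ≠ 0) (hfN : f.natDegree ≤ N) {S : ℝ} (hS0 : 0 ≤ S)
    (hS : 9 * ((monicIrreducibles K n).card : ℝ) ^ 12 * (Fintype.card K : ℝ) ^ F.natDegree ≤ S ^ 8) :
    |(((productTuples F a N n e).filter fun t => f ∣ t.1).card : ℝ) -
      (monicIrreducibles K e).card ^ 2 * ((Fintype.card K : ℝ) ^ (N - f.natDegree) *
        (monicIrreducibles K n).card ^ 2 / (Fintype.card K : ℝ) ^ F.natDegree)| ≤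
      (monicIrreducibles K e).card ^ 2 * S := by
  set W := monicIrreducibles K e ×ˢ monicIrreducibles K e
  set Z := polysLT K N ×ˢ (monicIrreducibles K n ×ˢ monicIrreducibles K n)
  set M : ℝ := (Fintype.card K : ℝ) ^ (N - f.natDegree) *
        (monicIrreducibles K n).card ^ 2 / (Fintype.card K : ℝ) ^ F.natDegree
  set cnt : K[X] × K[X] → ℕ := fun w =>
    (Z.filter fun t => f ∣ t.1 ∧ F ∣ t.1 * (t.2.1 * t.2.2) * (w.1 * w.2) - a).card
  have hW : (W.card : ℝ) = (monicIrreducibles K e).card ^ 2 := by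
    rw [Finset.card_product]
    push_cast
    ring
  have h1 : ((productTuples F a N n e).filter fun t => f ∣ t.1).card = ∑ w ∈ W, cnt w := by
    rw [Finset.card_eq_sum_card_fiberwise (f := fun t => t.2.2) (t := W)]
    · refine Finset.sum_congr rfl fun w hw => ?_
      refine Finset.card_bij (fun t _ => (t.1, t.2.1)) ?_ ?_ ?_
      · rintro ⟨u, v, w'⟩ ht
        simp only [Finset.mem_filter, mem_productTuples, tupleProduct] at ht
        obtain ⟨⟨⟨⟨hu, hv, -⟩, hd⟩, hf⟩, rfl⟩ := ht
        simp only [Z, Finset.mem_filter, Finset.mem_product]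
        exact ⟨⟨hu, hv⟩, hf, hd⟩
      · rintro ⟨u, v, w'⟩ ht ⟨u', v', w''⟩ ht' h
        have h1 := (Finset.mem_filter.1 ht).2
        have h2 := (Finset.mem_filter.1 ht').2
        simp only [Prod.mk.injEq] at h h1 h2 ⊢
        exact ⟨h.1, h.2, h1.trans h2.symm⟩
      · rintro ⟨u, v⟩ ht
        simp only [Z, Finset.mem_filter, Finset.mem_product] at ht
        obtain ⟨⟨hu, hv⟩, hf, hd⟩ := ht
        refine ⟨(u, v, w), ?_, rfl⟩
        simp only [Finset.mem_filter, mem_productTuples, tupleProduct]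
        exact ⟨⟨⟨⟨hu, hv, (Finset.mem_product.1 hw)⟩, hd⟩, hf⟩, trivial⟩
    · intro t ht
      have := (mem_productTuples.1 (Finset.mem_filter.1 ht).1).1.2.2
      exact Finset.mem_coe.2 (Finset.mem_product.2 this)
  have h2 : ∀ w ∈ W, |(cnt w : ℝ) - M| ≤ S := by
    intro w hw
    obtain ⟨hw1, hw2⟩ := Finset.mem_product.1 hw
    rw [mem_monicIrreducibles] at hw1 hw2
    have hFw : ¬ F ∣ w.1 * w.2 := by
      intro h
      rcases hF.prime.dvd_or_dvd h with h | h
      · have := natDegree_le_of_dvd h hw1.2.1.ne_zero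
        omega
      · have := natDegree_le_of_dvd h hw2.2.1.ne_zero
        omega
    obtain ⟨c, hc, hx⟩ := exists_mul_sub_dvd hF hFw ha
    have h3 := abs_card_triples_sub_le hF hn hn hN hf0 hfN hc hS0 (by
      refine le_trans (le_of_eq ?_) hS
      ring)
    simp only [cnt, hx]
    rw [mul_assoc ((Fintype.card K : ℝ) ^ (N - f.natDegree)), ← sq] at h3
    exact h3
  rw [h1, ← hW]
  push_cast
  rw [← nsmul_eq_mul, ← nsmul_eq_mul, ← Finset.sum_const, ← Finset.sum_const,
    ← Finset.sum_sub_distrib]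
  exact (Finset.abs_sum_le_sum_abs _ _).trans (Finset.sum_le_sum h2)

theorem natDegree_tupleProduct_lt {t : K[X] × (K[X] × K[X]) × (K[X] × K[X])}
    (ht : t ∈ productTuples F a N n e) (h0 : tupleProduct t ≠ 0) :
    (tupleProduct t).natDegree < N + 2 * n + 2 * e := by
  obtain ⟨⟨hu, ⟨hv, hv'⟩, hw, hw'⟩, -⟩ := mem_productTuples.1 ht
  rw [mem_monicIrreducibles] at hv hv' hw hw'
  have hu0 : t.1 ≠ 0 := by
    intro h
    simp [tupleProduct, h] at h0
  have hud := natDegree_lt_of_mem_degreeLT (mem_polysLT.1 hu) hu0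
  rw [tupleProduct, natDegree_mul (mul_ne_zero hu0 (mul_ne_zero hv.2.1.ne_zero hv'.2.1.ne_zero))
    (mul_ne_zero hw.2.1.ne_zero hw'.2.1.ne_zero),
    natDegree_mul hu0 (mul_ne_zero hv.2.1.ne_zero hv'.2.1.ne_zero),
    natDegree_mul hv.2.1.ne_zero hv'.2.1.ne_zero, natDegree_mul hw.2.1.ne_zero hw'.2.1.ne_zero]
  omega

theorem tupleProduct_ne_zero (ha : ¬ F ∣ a) {t : K[X] × (K[X] × K[X]) × (K[X] × K[X])}
    (ht : t ∈ productTuples F a N n e) : tupleProduct t ≠ 0 := by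
  intro h
  have := (mem_productTuples.1 ht).2
  rw [h, zero_sub, dvd_neg] at this
  exact ha this

omit [Fintype K] in
theorem card_toFinset_normalizedFactors_le {g : K[X]} (hg : g ≠ 0) :
    (UniqueFactorizationMonoid.normalizedFactors g).toFinset.card ≤ g.natDegree := by
  have h1 := natDegree_eq_of_degree_eq (degree_eq_degree_of_associated
    (UniqueFactorizationMonoid.prod_normalizedFactors hg))
  rw [natDegree_multiset_prod _ (UniqueFactorizationMonoid.zero_notMem_normalizedFactors g)] at h1
  refine (Multiset.toFinset_card_le _).trans ?_
  rw [← h1, ← Multiset.card_map natDegree]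
  have := Multiset.card_nsmul_le_sum (s := (UniqueFactorizationMonoid.normalizedFactors g).map
    natDegree) (a := 1) (by
      intro x hx
      obtain ⟨p, hp, rfl⟩ := Multiset.mem_map.1 hx
      exact (UniqueFactorizationMonoid.irreducible_of_normalized_factor p hp).natDegree_pos)
  simpa using this

theorem mem_normalizedFactors_of_mem_monicIrreducibles {d : ℕ} {p g : K[X]} (hg : g ≠ 0)
    (hp : p ∈ monicIrreducibles K d) (h : p ∣ g) :
    p ∈ (UniqueFactorizationMonoid.normalizedFactors g).toFinset := by
  rw [mem_monicIrreducibles] at hp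
  rw [Multiset.mem_toFinset, UniqueFactorizationMonoid.mem_normalizedFactors_iff' hg]
  exact ⟨hp.2.1, hp.1.normalize_eq_self, h⟩

theorem snd_injOn_tupleProduct_fiber (ha : ¬ F ∣ a) (g : K[X]) :
    Set.InjOn Prod.snd {t | t ∈ productTuples F a N n e ∧ tupleProduct t = g} := by
  rintro ⟨u, v, w⟩ ⟨ht, htg⟩ ⟨u', v', w'⟩ ⟨-, htg'⟩ h
  obtain ⟨rfl, rfl⟩ := Prod.mk.inj h
  have h0 := tupleProduct_ne_zero ha ht
  have h1 : u * ((v.1 * v.2) * (w.1 * w.2)) = u' * ((v.1 * v.2) * (w.1 * w.2)) := by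
    have := htg.trans htg'.symm
    simp only [tupleProduct] at this
    linear_combination this
  have h2 : (v.1 * v.2) * (w.1 * w.2) ≠ 0 := by
    intro h
    apply h0
    simp only [tupleProduct]
    linear_combination u * h
  rw [mul_right_cancel₀ h2 h1]

theorem snd_mem_of_mem_productTuples (ha : ¬ F ∣ a)
    {t : K[X] × (K[X] × K[X]) × (K[X] × K[X])} (ht : t ∈ productTuples F a N n e)
    {Φ : Finset K[X]}
    (hΦ : Φ = (UniqueFactorizationMonoid.normalizedFactors (tupleProduct t)).toFinset) :
    t.2 ∈ (Φ ×ˢ Φ) ×ˢ (Φ ×ˢ Φ) := by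
  obtain ⟨⟨-, ⟨hv, hv'⟩, hw, hw'⟩, -⟩ := mem_productTuples.1 ht
  have hmem : ∀ {d : ℕ} {p : K[X]}, p ∈ monicIrreducibles K d → p ∣ tupleProduct t → p ∈ Φ :=
    fun hp hd => hΦ ▸ mem_normalizedFactors_of_mem_monicIrreducibles
      (tupleProduct_ne_zero ha ht) hp hd
  rw [Finset.mem_product, Finset.mem_product, Finset.mem_product]
  exact ⟨⟨hmem hv ⟨t.1 * t.2.1.2 * (t.2.2.1 * t.2.2.2), by rw [tupleProduct]; ring⟩,
    hmem hv' ⟨t.1 * t.2.1.1 * (t.2.2.1 * t.2.2.2), by rw [tupleProduct]; ring⟩⟩,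
    hmem hw ⟨t.1 * (t.2.1.1 * t.2.1.2) * t.2.2.2, by rw [tupleProduct]; ring⟩,
    hmem hw' ⟨t.1 * (t.2.1.1 * t.2.1.2) * t.2.2.1, by rw [tupleProduct]; ring⟩⟩

/-- The four irreducible entries lie among the at most `deg g` monic irreducible factors of `g`, and
they determine `u`. -/
theorem card_fiber_tupleProduct_le (ha : ¬ F ∣ a) (g : K[X]) :
    ((productTuples F a N n e).filter fun t => tupleProduct t = g).card ≤
      (N + 2 * n + 2 * e) ^ 4 := by
  rcases ((productTuples F a N n e).filter fun t => tupleProduct t = g).eq_empty_or_nonempty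
    with h | ⟨t₀, ht₀⟩
  · rw [h, Finset.card_empty]
    exact Nat.zero_le _
  obtain ⟨ht₀, htg⟩ := Finset.mem_filter.1 ht₀
  have hg0 : g ≠ 0 := htg ▸ tupleProduct_ne_zero ha ht₀
  obtain ⟨Φ, hΦ⟩ : ∃ Φ, Φ = (UniqueFactorizationMonoid.normalizedFactors g).toFinset := ⟨_, rfl⟩
  have hΦc : Φ.card ≤ N + 2 * n + 2 * e := by
    rw [hΦ]
    refine (card_toFinset_normalizedFactors_le hg0).trans ?_
    rw [← htg]
    exact (natDegree_tupleProduct_lt ht₀ (htg ▸ hg0)).le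
  have hc : ((Φ ×ˢ Φ) ×ˢ (Φ ×ˢ Φ)).card ≤ (N + 2 * n + 2 * e) ^ 4 := by
    rw [Finset.card_product, Finset.card_product]
    refine le_trans (le_of_eq ?_) (Nat.pow_le_pow_left hΦc 4)
    ring
  refine le_trans ?_ hc
  refine Finset.card_le_card_of_injOn Prod.snd (fun t ht => ?_) fun t ht t' ht' h => ?_
  · obtain ⟨ht, htg⟩ := Finset.mem_filter.1 ht
    exact snd_mem_of_mem_productTuples ha ht (by rw [hΦ, htg])
  · exact snd_injOn_tupleProduct_fiber ha g (Finset.mem_filter.1 ht) (Finset.mem_filter.1 ht') h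

theorem card_le_mul_card_image_tupleProduct (ha : ¬ F ∣ a)
    {s : Finset (K[X] × (K[X] × K[X]) × (K[X] × K[X]))} (hs : s ⊆ productTuples F a N n e) :
    s.card ≤ (N + 2 * n + 2 * e) ^ 4 * (s.image tupleProduct).card := by
  refine Finset.card_le_mul_card_image _ _ fun g _ => ?_
  exact (Finset.card_le_card (Finset.filter_subset_filter _ hs)).trans
    (card_fiber_tupleProduct_le ha g)

/-- Write `g = p² h` and count `h` in a residue class modulo `F`. Products are counted rather than
tuples, which avoids any equidistribution input for large `p`. -/
theorem card_image_le_of_large_square_factor (hF : Irreducible F) (ha : ¬ F ∣ a) {D₀ E : ℕ}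
    (hD : N + 2 * n + 2 * e = F.natDegree + D₀ + E) (hNE : N ≤ 2 * E) (hnE : n ≤ E) (heE : e ≤ E) :
    (((productTuples F a N n e).filter fun t =>
      ∃ p : K[X], Irreducible p ∧ D₀ ≤ p.natDegree ∧ p * p ∣ tupleProduct t).image
        tupleProduct).card ≤ (E + 1) * Fintype.card K ^ E := by
  set H : K[X] → ℕ → Finset K[X] := fun p d =>
    ((polysLT K (N + 2 * n + 2 * e - 2 * d)).filter fun h => F ∣ p * p * h - a).image
      fun h => p * p * h
  have hsub : ((productTuples F a N n e).filter fun t =>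
      ∃ p : K[X], Irreducible p ∧ D₀ ≤ p.natDegree ∧ p * p ∣ tupleProduct t).image tupleProduct ⊆
      (Finset.Icc D₀ E).biUnion fun d =>
        ((monicIrreducibles K d).filter fun p => ¬ F ∣ p * p).biUnion fun p => H p d := by
    intro g hg
    obtain ⟨t, ht, rfl⟩ := Finset.mem_image.1 hg
    obtain ⟨ht, p₀, hp₀, hpD, hpd₀⟩ := Finset.mem_filter.1 ht
    have hg0 := tupleProduct_ne_zero ha ht
    set p := normalize p₀
    have hass : Associated p p₀ := normalize_associated p₀
    have hp : Irreducible p := hass.symm.irreducible hp₀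
    have hpm : p.Monic := monic_normalize hp₀.ne_zero
    have hdeg : p.natDegree = p₀.natDegree :=
      natDegree_eq_of_degree_eq (degree_eq_degree_of_associated hass)
    obtain ⟨h, hh⟩ : p * p ∣ tupleProduct t := ((hass.mul_mul hass).dvd_iff_dvd_left).2 hpd₀
    have hd := (mem_productTuples.1 ht).2
    -- If `deg p > E`, then `p` is coprime to the four irreducible entries, so `p²` divides `u`,
    -- whose degree is below `N ≤ 2E`.
    have hpE : p.natDegree ≤ E := by
      obtain ⟨⟨hu, ⟨hv, hv'⟩, hw, hw'⟩, -⟩ := mem_productTuples.1 ht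
      rw [mem_monicIrreducibles] at hv hv' hw hw'
      have aux : ∀ {x : K[X]} {j : ℕ}, j ≤ E → x.Monic ∧ Irreducible x ∧ x.natDegree = j →
          ¬ p.natDegree ≤ E → IsCoprime (p * p) x := by
        intro x j hj hx hpE
        have : IsCoprime p x := hp.coprime_iff_not_dvd.2 fun hdvd => by
          have := natDegree_le_of_dvd hdvd hx.2.1.ne_zero
          omega
        exact this.mul_left this
      by_contra hpE
      have hdu : p * p ∣ t.1 := by
        have h1 : p * p ∣ t.1 * (t.2.1.1 * t.2.1.2) * (t.2.2.1 * t.2.2.2) := ⟨h, hh⟩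
        have h2 := ((aux heE hw hpE).mul_right (aux heE hw' hpE)).dvd_of_dvd_mul_right h1
        exact ((aux hnE hv hpE).mul_right (aux hnE hv' hpE)).dvd_of_dvd_mul_right h2
      have hu0 : t.1 ≠ 0 := by
        intro h
        simp [tupleProduct, h] at hg0
      have h3 := natDegree_le_of_dvd hdu hu0
      have h4 := natDegree_lt_of_mem_degreeLT (mem_polysLT.1 hu) hu0
      rw [natDegree_mul hp.ne_zero hp.ne_zero] at h3
      omega
    simp only [Finset.mem_biUnion, Finset.mem_Icc, Finset.mem_filter, mem_monicIrreducibles]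
    refine ⟨p.natDegree, ⟨hdeg ▸ hpD, hpE⟩, p, ⟨⟨hpm, hp, rfl⟩, fun hFp => ha ?_⟩, ?_⟩
    · have h1 := dvd_sub ((hFp.mul_right h)) (hh ▸ hd)
      rwa [sub_sub_cancel] at h1
    · refine Finset.mem_image.2 ⟨h, Finset.mem_filter.2 ⟨mem_polysLT.2 ?_, hh ▸ hd⟩, hh.symm⟩
      have hpp : (p * p).natDegree = 2 * p.natDegree := by
        rw [natDegree_mul hp.ne_zero hp.ne_zero, two_mul]
      have h1 := natDegree_tupleProduct_lt ht hg0
      have h2 := natDegree_le_of_dvd ⟨h, hh⟩ hg0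
      refine (mul_mem_degreeLT_iff (mul_ne_zero hp.ne_zero hp.ne_zero) hpp (by omega)).1 ?_
      rw [← hh]
      exact mem_degreeLT_of_natDegree_lt h1
  refine (Finset.card_le_card hsub).trans (Finset.card_biUnion_le.trans ?_)
  have hbound : ∀ d ∈ Finset.Icc D₀ E, (((monicIrreducibles K d).filter fun p =>
      ¬ F ∣ p * p).biUnion fun p => H p d).card ≤ Fintype.card K ^ E := by
    intro d hd
    rw [Finset.mem_Icc] at hd
    refine (Finset.card_biUnion_le_card_mul _ _ (Fintype.card K ^
      (N + 2 * n + 2 * e - 2 * d - F.natDegree)) fun p hp => ?_).trans ?_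
    · exact Finset.card_image_le.trans
        (card_filter_dvd_mul_sub_le hF (Finset.mem_filter.1 hp).2 a _)
    · calc _ ≤ Fintype.card K ^ d *
            Fintype.card K ^ (N + 2 * n + 2 * e - 2 * d - F.natDegree) :=
            Nat.mul_le_mul_right _ ((Finset.card_filter_le _ _).trans
              (card_monicIrreducibles_le d))
        -- The exponent is `d + max (D₀ + E - 2d) 0`, at most `E` because `D₀ ≤ d ≤ E`.
        _ ≤ _ := by
            rw [← pow_add]
            exact Nat.pow_le_pow_right Fintype.card_pos (by omega)
  refine (Finset.sum_le_sum hbound).trans ?_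
  rw [Finset.sum_const, smul_eq_mul, Nat.card_Icc]
  exact Nat.mul_le_mul_right _ (by omega)

variable (K) in
theorem sum_card_monicIrreducibles_add_one_le (D₀ : ℕ) :
    ∑ d ∈ Finset.Ico 1 D₀, (monicIrreducibles K d).card + 1 ≤ Fintype.card K ^ D₀ := by
  refine (Nat.add_le_add_right (Finset.sum_le_sum fun d _ => card_monicIrreducibles_le d) 1).trans ?_
  have hq : 2 ≤ Fintype.card K := Fintype.one_lt_card
  induction D₀ with
  | zero => simp
  | succ d ih =>
    rcases Nat.eq_zero_or_pos d with rfl | hd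
    · simpa using Nat.one_le_of_lt hq
    rw [Finset.sum_Ico_succ_top (show 1 ≤ d from hd), pow_succ]
    have := Nat.mul_le_mul_left (Fintype.card K ^ d) hq
    omega

theorem card_image_le_PsiSharp {k m : ℝ} (hk : ((N + 2 * n + 2 * e : ℕ) : ℝ) ≤ k)
    (hNm : (N : ℝ) ≤ m) (hnm : (n : ℝ) ≤ m) (hem : (e : ℝ) ≤ m) :
    (((productTuples F a N n e).filter fun t => Squarefree (tupleProduct t)).image
      tupleProduct).card ≤ PsiSharp k m F a := by
  rw [PsiSharp, ← Set.ncard_coe_finset]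
  refine Set.ncard_le_ncard ?_ (smoothSqfreeSet_finite k m F a)
  intro g hg
  obtain ⟨t, ht, rfl⟩ := Finset.mem_image.1 (Finset.mem_coe.1 hg)
  obtain ⟨ht, hsq⟩ := Finset.mem_filter.1 ht
  have h0 := hsq.ne_zero
  refine ⟨(mem_productTuples.1 ht).2, ?_, ?_, hsq⟩
  · exact lt_of_lt_of_le (Nat.cast_lt.2 (natDegree_tupleProduct_lt ht h0)) hk
  · intro p hp hd
    obtain ⟨⟨hu, ⟨hv, hv'⟩, hw, hw'⟩, -⟩ := mem_productTuples.1 ht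
    rw [mem_monicIrreducibles] at hv hv' hw hw'
    have aux : ∀ {x : K[X]} {j : ℕ}, x.Monic ∧ Irreducible x ∧ x.natDegree = j → (j : ℝ) ≤ m →
        p ∣ x → (p.natDegree : ℝ) ≤ m := by
      intro x j hx hj hpx
      refine le_trans (Nat.cast_le.2 ?_) hj
      exact hx.2.2 ▸ natDegree_le_of_dvd hpx hx.2.1.ne_zero
    rcases hp.prime.dvd_or_dvd hd with h | h
    · rcases hp.prime.dvd_or_dvd h with h | h
      · have hu0 : t.1 ≠ 0 := by
          intro h
          simp [tupleProduct, h] at h0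
        refine le_trans (Nat.cast_le.2 ?_) hNm
        exact (natDegree_le_of_dvd h hu0).trans
          (natDegree_lt_of_mem_degreeLT (mem_polysLT.1 hu) hu0).le
      · rcases hp.prime.dvd_or_dvd h with h | h
        · exact aux hv hnm h
        · exact aux hv' hnm h
    · rcases hp.prime.dvd_or_dvd h with h | h
      · exact aux hw hem h
      · exact aux hw' hem h

theorem card_filter_sq_dvd_productTuples_le (hF : Irreducible F) (ha : ¬ F ∣ a)
    (hn : 3 * n < F.natDegree) (he : e < F.natDegree) (hN : N ≤ F.natDegree) {S : ℝ} (hS0 : 0 ≤ S)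
    (hS : 9 * ((monicIrreducibles K n).card : ℝ) ^ 12 * (Fintype.card K : ℝ) ^ F.natDegree ≤ S ^ 8)
    {d : ℕ} (hd : 2 * d ≤ N) {p : K[X]} (hp : p ∈ monicIrreducibles K d) :
    (((productTuples F a N n e).filter fun t => p * p ∣ t.1).card : ℝ) ≤
      (monicIrreducibles K e).card ^ 2 * ((Fintype.card K : ℝ) ^ N *
        (monicIrreducibles K n).card ^ 2 / (Fintype.card K : ℝ) ^ F.natDegree *
          (1 / ((Fintype.card K : ℝ) ^ d) ^ 2) + S) := by
  rw [mem_monicIrreducibles] at hp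
  have hpp : (p * p).natDegree = 2 * d := by
    rw [natDegree_mul hp.2.1.ne_zero hp.2.1.ne_zero, hp.2.2, two_mul]
  have hq : (Fintype.card K : ℝ) ≠ 0 := Nat.cast_ne_zero.2 Fintype.card_ne_zero
  have h1 := abs_card_filter_dvd_productTuples_sub_le (e := e) hF ha hn he hN
    (mul_ne_zero hp.2.1.ne_zero hp.2.1.ne_zero) (hpp.trans_le hd) hS0 hS
  have h2 := (abs_le.1 h1).2
  rw [hpp, pow_sub₀ _ hq hd, mul_comm 2 d, pow_mul, ← one_div] at h2
  refine (sub_le_iff_le_add.1 h2).trans_eq ?_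
  ring

/-- Union bound for small square factors. The `-1` beside `q ^ D₀` leaves room for the one further
error `S` in the total count. -/
theorem sum_card_filter_sq_dvd_productTuples_le (hF : Irreducible F) (ha : ¬ F ∣ a)
    (hn : 3 * n < F.natDegree) (he : e < F.natDegree) (hN : N ≤ F.natDegree)
    {D₀ : ℕ} (hD₀N : 2 * D₀ ≤ N) {S : ℝ} (hS0 : 0 ≤ S)
    (hS : 9 * ((monicIrreducibles K n).card : ℝ) ^ 12 * (Fintype.card K : ℝ) ^ F.natDegree ≤ S ^ 8) :
    (∑ d ∈ Finset.Ico 1 D₀, ∑ p ∈ monicIrreducibles K d,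
      (((productTuples F a N n e).filter fun t => p * p ∣ t.1).card : ℝ)) ≤
      (monicIrreducibles K e).card ^ 2 * (3 / 4 * ((Fintype.card K : ℝ) ^ N *
        (monicIrreducibles K n).card ^ 2 / (Fintype.card K : ℝ) ^ F.natDegree) +
        ((Fintype.card K : ℝ) ^ D₀ - 1) * S) := by
  have hterm : ∀ d ∈ Finset.Ico 1 D₀, ∀ p ∈ monicIrreducibles K d, _ := fun d hd p hp =>
    card_filter_sq_dvd_productTuples_le (a := a) (e := e) hF ha hn he hN hS0 hS
      (show 2 * d ≤ N by have := Finset.mem_Ico.1 hd; omega) hp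
  refine (Finset.sum_le_sum fun d hd => Finset.sum_le_sum (hterm d hd)).trans ?_
  have h1 := sum_card_monicIrreducibles_div_sq_le K D₀
  have h2 : ∑ d ∈ Finset.Ico 1 D₀, ((monicIrreducibles K d).card : ℝ) ≤
      (Fintype.card K : ℝ) ^ D₀ - 1 := by
    rw [le_sub_iff_add_le]
    exact_mod_cast sum_card_monicIrreducibles_add_one_le K D₀
  have hM : 0 ≤ (Fintype.card K : ℝ) ^ N * (monicIrreducibles K n).card ^ 2 /
    (Fintype.card K : ℝ) ^ F.natDegree := by positivity
  generalize (Fintype.card K : ℝ) ^ N * (monicIrreducibles K n).card ^ 2 /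
    (Fintype.card K : ℝ) ^ F.natDegree = M at hM ⊢
  generalize (Fintype.card K : ℝ) = q at h1 h2 ⊢
  generalize ((monicIrreducibles K e).card : ℝ) = Y
  have h3 : ∑ d ∈ Finset.Ico 1 D₀, ∑ p ∈ monicIrreducibles K d,
      Y ^ 2 * (M * (1 / (q ^ d) ^ 2) + S) =
      Y ^ 2 * (M * ∑ d ∈ Finset.Ico 1 D₀, (monicIrreducibles K d).card / (q ^ d) ^ 2 +
        (∑ d ∈ Finset.Ico 1 D₀, ((monicIrreducibles K d).card : ℝ)) * S) := by
    simp_rw [Finset.sum_const, nsmul_eq_mul]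
    rw [Finset.mul_sum, Finset.sum_mul, ← Finset.sum_add_distrib, Finset.mul_sum]
    exact Finset.sum_congr rfl fun d _ => by ring
  rw [h3, mul_comm (3 / 4 : ℝ)]
  gcongr

/-- A lower bound for the number of square-free smooth polynomials in a residue class, from
counting products of one arbitrary polynomial and four irreducible ones. -/
theorem le_mul_PsiSharp (hF : Irreducible F) (ha : ¬ F ∣ a)
    (hn : 3 * n < F.natDegree) (he : e < F.natDegree) (hN : N ≤ F.natDegree)
    {D₀ E : ℕ} (hD : N + 2 * n + 2 * e = F.natDegree + D₀ + E) (hD₀n : D₀ ≤ n) (hD₀e : D₀ ≤ e)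
    (hD₀N : 2 * D₀ ≤ N) (hNE : N ≤ 2 * E) (hnE : n ≤ E) (heE : e ≤ E)
    {k m : ℝ} (hk : ((N + 2 * n + 2 * e : ℕ) : ℝ) ≤ k)
    (hNm : (N : ℝ) ≤ m) (hnm : (n : ℝ) ≤ m) (hem : (e : ℝ) ≤ m) {S : ℝ} (hS0 : 0 ≤ S)
    (hS : 9 * ((monicIrreducibles K n).card : ℝ) ^ 12 * (Fintype.card K : ℝ) ^ F.natDegree ≤ S ^ 8) :
    (monicIrreducibles K e).card ^ 2 * ((Fintype.card K : ℝ) ^ N *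
        (monicIrreducibles K n).card ^ 2 / (Fintype.card K : ℝ) ^ F.natDegree / 4 -
        (Fintype.card K : ℝ) ^ D₀ * S) ≤
      ((N + 2 * n + 2 * e : ℕ) : ℝ) ^ 4 *
        (PsiSharp k m F a + (E + 1) * (Fintype.card K : ℝ) ^ E) := by
  set T := productTuples F a N n e
  set good := T.filter fun t => Squarefree (tupleProduct t)
  set large := T.filter fun t =>
    ∃ p : K[X], Irreducible p ∧ D₀ ≤ p.natDegree ∧ p * p ∣ tupleProduct t
  set small := (Finset.Ico 1 D₀).biUnion fun d => (monicIrreducibles K d).biUnion fun p =>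
    T.filter fun t => p * p ∣ t.1
  have hcover : T ⊆ good ∪ (large ∪ small) := by
    intro t ht
    by_cases hsq : Squarefree (tupleProduct t)
    · exact Finset.mem_union_left _ (Finset.mem_filter.2 ⟨ht, hsq⟩)
    refine Finset.mem_union_right _ ?_
    obtain ⟨p₀, hp₀, hpd₀⟩ : ∃ p : K[X], Irreducible p ∧ p * p ∣ tupleProduct t := by
      by_contra! hcon
      exact hsq ((squarefree_iff_irreducible_sq_not_dvd_of_ne_zero
        (tupleProduct_ne_zero ha ht)).2 hcon)
    by_cases hpD : D₀ ≤ p₀.natDegree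
    · exact Finset.mem_union_left _ (Finset.mem_filter.2 ⟨ht, p₀, hp₀, hpD, hpd₀⟩)
    refine Finset.mem_union_right _ ?_
    have hass : Associated (normalize p₀) p₀ := normalize_associated p₀
    have hp : Irreducible (normalize p₀) := hass.symm.irreducible hp₀
    have hpm : (normalize p₀).Monic := monic_normalize hp₀.ne_zero
    have hdeg : (normalize p₀).natDegree = p₀.natDegree :=
      natDegree_eq_of_degree_eq (degree_eq_degree_of_associated hass)
    have hpd : normalize p₀ * normalize p₀ ∣ tupleProduct t :=
      ((hass.mul_mul hass).dvd_iff_dvd_left).2 hpd₀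
    obtain ⟨⟨hu, ⟨hv, hv'⟩, hw, hw'⟩, -⟩ := mem_productTuples.1 ht
    rw [mem_monicIrreducibles] at hv hv' hw hw'
    have aux : ∀ {x : K[X]} {j : ℕ}, D₀ ≤ j → x.Monic ∧ Irreducible x ∧ x.natDegree = j →
        IsCoprime (normalize p₀ * normalize p₀) x := by
      intro x j hj hx
      have : IsCoprime (normalize p₀) x := isCoprime_of_monic_irreducible_ne hpm hp hx.1 hx.2.1
        fun h => by
          have := congrArg natDegree h
          omega
      exact this.mul_left this
    -- An irreducible of degree below `D₀` is coprime to `v, v', w, w'`, so its square must divide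
    -- `u`.
    have h2 := ((aux hD₀e hw).mul_right (aux hD₀e hw')).dvd_of_dvd_mul_right hpd
    have h3 := ((aux hD₀n hv).mul_right (aux hD₀n hv')).dvd_of_dvd_mul_right h2
    simp only [small, Finset.mem_biUnion, Finset.mem_Ico]
    exact ⟨p₀.natDegree, ⟨hp₀.natDegree_pos, by omega⟩, normalize p₀,
      mem_monicIrreducibles.2 ⟨hpm, hp, hdeg⟩, Finset.mem_filter.2 ⟨ht, h3⟩⟩
  have hT : (T.card : ℝ) ≤ good.card + (large.card + small.card) := by
    exact_mod_cast (Finset.card_le_card hcover).trans ((Finset.card_union_le _ _).trans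
      (Nat.add_le_add_left (Finset.card_union_le _ _) _))
  have hTlow := (abs_le.1 (abs_card_filter_dvd_productTuples_sub_le (e := e) hF ha hn he hN
    (f := 1) one_ne_zero (by simp) hS0 hS)).1
  have hT1 : (T.filter fun t => (1 : K[X]) ∣ t.1) = T :=
    Finset.filter_true_of_mem fun t _ => one_dvd _
  rw [hT1, natDegree_one, Nat.sub_zero] at hTlow
  have hgood : (good.card : ℝ) ≤ ((N + 2 * n + 2 * e : ℕ) : ℝ) ^ 4 * PsiSharp k m F a := by
    exact_mod_cast (card_le_mul_card_image_tupleProduct ha (Finset.filter_subset _ _)).trans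
      (Nat.mul_le_mul_left _ (card_image_le_PsiSharp hk hNm hnm hem))
  have hlarge : (large.card : ℝ) ≤ ((N + 2 * n + 2 * e : ℕ) : ℝ) ^ 4 *
      ((E + 1) * (Fintype.card K : ℝ) ^ E) := by
    exact_mod_cast (card_le_mul_card_image_tupleProduct ha (Finset.filter_subset _ _)).trans
      (Nat.mul_le_mul_left _ (card_image_le_of_large_square_factor hF ha hD hNE hnE heE))
  have hsmall : (small.card : ℝ) ≤ ∑ d ∈ Finset.Ico 1 D₀, ∑ p ∈ monicIrreducibles K d,
      ((T.filter fun t => p * p ∣ t.1).card : ℝ) := by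
    exact_mod_cast Finset.card_biUnion_le.trans
      (Finset.sum_le_sum fun d _ => Finset.card_biUnion_le)
  have hsmall' := hsmall.trans (sum_card_filter_sq_dvd_productTuples_le (e := e) hF ha hn he hN hD₀N hS0 hS)
  nlinarith

end ProductTuples

/-! ### An explicit lower bound. -/

section ExplicitLowerBound

variable {K : Type*} [Field K] [Fintype K]

theorem pow_le_two_mul_mul_card_monicIrreducibles {n r : ℕ} (hn : n ≠ 0) (hr : n ≤ r) :
    (Fintype.card K : ℝ) ^ n ≤ 2 * r * (monicIrreducibles K n).card := by
  have h := (card_pow_le_two_mul_card_monicIrreducibles (K := K) hn).trans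
    (Nat.mul_le_mul_right _ (Nat.mul_le_mul_left 2 hr))
  exact_mod_cast h

theorem pow_le_mul_PsiSharp {F a : K[X]} {N n e : ℕ} (hF : Irreducible F) (ha : ¬ F ∣ a)
    (hn0 : n ≠ 0) (he0 : e ≠ 0)
    (hn : 3 * n < F.natDegree) (he : e < F.natDegree) (hN : N ≤ F.natDegree)
    {D₀ E : ℕ} (hD : N + 2 * n + 2 * e = F.natDegree + D₀ + E) (hD₀n : D₀ ≤ n) (hD₀e : D₀ ≤ e)
    (hD₀N : 2 * D₀ ≤ N) (hNE : N ≤ 2 * E) (hnE : n ≤ E) (heE : e ≤ E)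
    (hD3 : N + 2 * n + 2 * e ≤ 3 * F.natDegree)
    {k m : ℝ} (hk : ((N + 2 * n + 2 * e : ℕ) : ℝ) ≤ k)
    (hNm : (N : ℝ) ≤ m) (hnm : (n : ℝ) ≤ m) (hem : (e : ℝ) ≤ m)
    (hq1 : 9 * 8 ^ 8 * 16 * (F.natDegree : ℝ) ^ 4 *
      (Fintype.card K : ℝ) ^ (8 * D₀ + 9 * F.natDegree) ≤ (Fintype.card K : ℝ) ^ (4 * n + 8 * N))
    (hq2 : 3 ^ 5 * 256 * (F.natDegree : ℝ) ^ 9 ≤ (Fintype.card K : ℝ) ^ D₀) :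
    (Fintype.card K : ℝ) ^ (D₀ + E) ≤
      256 * 81 * (F.natDegree : ℝ) ^ 8 * PsiSharp k m F a := by
  have hX1 := pow_le_two_mul_mul_card_monicIrreducibles (K := K) hn0 (r := F.natDegree) (by omega)
  have hY1 := pow_le_two_mul_mul_card_monicIrreducibles (K := K) he0 (r := F.natDegree) (by omega)
  have main : ∀ S : ℝ, 0 ≤ S → _ → _ := fun S hS0 hS => le_mul_PsiSharp hF ha hn he hN hD hD₀n hD₀e
    hD₀N hNE hnE heE hk hNm hnm hem hS0 hS
  have hDr : ((N + 2 * n + 2 * e : ℕ) : ℝ) ≤ 3 * (F.natDegree : ℝ) := by exact_mod_cast hD3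
  have hEr : (E : ℝ) + 1 ≤ 3 * (F.natDegree : ℝ) := by
    have : E + 1 ≤ 3 * F.natDegree := by omega
    exact_mod_cast this
  have hr : (0 : ℝ) < F.natDegree := Nat.cast_pos.2 hF.natDegree_pos
  have hq : (0 : ℝ) < Fintype.card K := Nat.cast_pos.2 Fintype.card_pos
  have hΨ : (0 : ℝ) ≤ PsiSharp k m F a := Nat.cast_nonneg _
  have hD0 : (0 : ℝ) ≤ ((N + 2 * n + 2 * e : ℕ) : ℝ) := Nat.cast_nonneg _
  have hX0 : (0 : ℝ) ≤ (monicIrreducibles K n).card := Nat.cast_nonneg _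
  generalize ((N + 2 * n + 2 * e : ℕ) : ℝ) = D at main hDr hD0
  generalize (PsiSharp k m F a : ℝ) = Ψ at main hΨ ⊢
  generalize ((monicIrreducibles K n).card : ℝ) = X at main hX1 hX0
  generalize ((monicIrreducibles K e).card : ℝ) = Y at main hY1
  generalize F.natDegree = d at *
  generalize (Fintype.card K : ℝ) = q at *
  generalize (d : ℝ) = r at *
  have hqd : 0 < q ^ d := pow_pos hq _
  have hqD₀ : 0 < q ^ D₀ := pow_pos hq _
  have hX4 : q ^ (4 * n) ≤ 16 * r ^ 4 * X ^ 4 := by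
    calc q ^ (4 * n) = (q ^ n) ^ 4 := by rw [← pow_mul, mul_comm]
      _ ≤ (2 * r * X) ^ 4 := by gcongr
      _ = _ := by ring
  -- This `S` makes the accumulated error `q ^ D₀ * S` one eighth of the main term, half of the
  -- quarter left by the sieve; `hq1` makes it admissible.
  have h1 := main (q ^ N * X ^ 2 / q ^ d / (8 * q ^ D₀)) (by positivity) (by
    have h2 : 9 * 8 ^ 8 * q ^ (8 * D₀ + 9 * d) ≤ X ^ 4 * q ^ (8 * N) := by
      have h3 : (16 * r ^ 4) * (9 * 8 ^ 8 * q ^ (8 * D₀ + 9 * d)) ≤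
          (16 * r ^ 4) * (X ^ 4 * q ^ (8 * N)) := by
        calc _ = 9 * 8 ^ 8 * 16 * r ^ 4 * q ^ (8 * D₀ + 9 * d) := by ring
          _ ≤ q ^ (4 * n) * q ^ (8 * N) := by rw [← pow_add]; exact hq1
          _ ≤ (16 * r ^ 4 * X ^ 4) * q ^ (8 * N) := by gcongr
          _ = _ := by ring
      exact le_of_mul_le_mul_left h3 (by positivity)
    rw [div_div, div_pow, le_div_iff₀ (by positivity)]
    calc 9 * X ^ 12 * q ^ d * (q ^ d * (8 * q ^ D₀)) ^ 8
        = X ^ 12 * (9 * 8 ^ 8 * q ^ (8 * D₀ + 9 * d)) := by ring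
      _ ≤ X ^ 12 * (X ^ 4 * q ^ (8 * N)) := by gcongr
      _ = _ := by ring)
  have h2 : q ^ D₀ * (q ^ N * X ^ 2 / q ^ d / (8 * q ^ D₀)) = q ^ N * X ^ 2 / q ^ d / 8 := by
    field_simp
  rw [h2] at h1
  have h3 : q ^ (D₀ + E) ≤ 16 * r ^ 4 * (Y ^ 2 * (q ^ N * X ^ 2 / q ^ d)) := by
    have h4 : q ^ (D₀ + E) = (q ^ e) ^ 2 * (q ^ N * (q ^ n) ^ 2 / q ^ d) := by
      field_simp
      rw [← pow_mul, ← pow_mul, ← pow_add, ← pow_add, ← pow_add]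
      congr 1
      omega
    rw [h4]
    calc (q ^ e) ^ 2 * (q ^ N * (q ^ n) ^ 2 / q ^ d)
        ≤ (2 * r * Y) ^ 2 * (q ^ N * (2 * r * X) ^ 2 / q ^ d) := by gcongr
      _ = _ := by ring
  have h5 : D ^ 4 * (Ψ + (E + 1) * q ^ E) ≤ 81 * r ^ 4 * Ψ + 3 ^ 5 * r ^ 5 * q ^ E := by
    calc D ^ 4 * (Ψ + (E + 1) * q ^ E) ≤ (3 * r) ^ 4 * (Ψ + (3 * r) * q ^ E) := by gcongr
      _ = _ := by ring
  have h6 : 3 ^ 5 * 256 * r ^ 9 * q ^ E ≤ q ^ (D₀ + E) := by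
    rw [pow_add]
    gcongr
  have h7 : Y ^ 2 * (q ^ N * X ^ 2 / q ^ d) / 8 ≤ 81 * r ^ 4 * Ψ + 3 ^ 5 * r ^ 5 * q ^ E :=
    le_trans (by linarith) (h1.trans h5)
  have h8 : 128 * r ^ 4 * (Y ^ 2 * (q ^ N * X ^ 2 / q ^ d) / 8) ≤
      128 * r ^ 4 * (81 * r ^ 4 * Ψ + 3 ^ 5 * r ^ 5 * q ^ E) := by gcongr
  -- By `h6` the `q ^ E` term is at most half of `q ^ (D₀ + E)` and is absorbed.
  have h9 : 128 * r ^ 4 * (81 * r ^ 4 * Ψ + 3 ^ 5 * r ^ 5 * q ^ E) =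
      (256 * 81 * r ^ 8 * Ψ + 3 ^ 5 * 256 * r ^ 9 * q ^ E) / 2 := by ring
  linarith

end ExplicitLowerBound

/-! ### Choice of degrees and asymptotics. -/

theorem eventually_const_mul_pow_le_two_rpow {c : ℝ} (hc : 0 < c) (C b : ℝ) (j : ℕ) :
    ∀ᶠ r : ℕ in atTop, C * (r : ℝ) ^ j ≤ (2 : ℝ) ^ (c * r - b) := by
  have h1 : (1 : ℝ) < 2 ^ c := Real.one_lt_rpow (by norm_num) hc
  have h2 := ((isLittleO_pow_const_const_pow_of_one_lt (R := ℝ) j h1).const_mul_left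
    (C * 2 ^ b)).bound (c := 1) one_pos
  filter_upwards [h2] with r hr
  have h3 : ((2 : ℝ) ^ c) ^ r = 2 ^ (c * r) := by rw [Real.rpow_mul_natCast (by norm_num)]
  rw [one_mul, h3, Real.norm_of_nonneg (Real.rpow_nonneg (by norm_num) _)] at hr
  rw [Real.rpow_sub (by norm_num), le_div_iff₀ (by positivity)]
  refine le_trans (le_of_eq ?_) ((Real.le_norm_self _).trans hr)
  ring

theorem eventually_le_const_mul_nat {c : ℝ} (hc : 0 < c) (b : ℝ) :
    ∀ᶠ r : ℕ in atTop, b ≤ c * r :=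
  (tendsto_natCast_atTop_atTop.const_mul_atTop hc).eventually_ge_atTop b

theorem floor_mul_natCast_bounds {x : ℝ} (hx : 0 ≤ x) (r : ℕ) :
    (⌊x * r⌋₊ : ℝ) ≤ x * r ∧ x * r - 1 < ⌊x * r⌋₊ :=
  ⟨Nat.floor_le (by positivity), by linarith [Nat.lt_floor_add_one (x * r)]⟩

/-- The admissible degrees of the factors: `x` and `y` stand for `α * r` and `β * r`, and `z` for
a small positive multiple of `r`. -/
theorem exists_factor_degrees {α β s : ℝ} (hβ : β ≤ 1) (hs0 : 0 < s)
    (hs1 : s ≤ (α - 9 / 2 + 3 * β) / 8) {r : ℕ} {x y z : ℝ} (hx : x = α * r) (hy : y = β * r)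
    (hz : z = s * r) (hy2 : y ≤ r) (hzx : 8 * z ≤ x - 9 / 2 * r + 3 * y)
    (hzy : z ≤ y - 23 / 24 * r) (hz100 : 100 ≤ z) :
    ∃ N n e D₀ E : ℕ, (N : ℝ) + 2 * n + 2 * e = r + D₀ + E ∧
      (y - 1 < N ∧ N ≤ y) ∧
      (r / 4 + 2 * r - 2 * y + z - 1 < n ∧ n ≤ r / 4 + 2 * r - 2 * y + z) ∧
      (x / 2 - 9 / 4 * r + 3 / 2 * y - 2 * z - 1 < e ∧
        e ≤ x / 2 - 9 / 4 * r + 3 / 2 * y - 2 * z) ∧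
      (z / 4 - 1 < D₀ ∧ D₀ ≤ z / 4) := by
  have hβ0 : 0 ≤ β := by
    by_contra h
    have : β * r ≤ 0 := mul_nonpos_of_nonpos_of_nonneg (by linarith) (by linarith)
    linarith
  obtain ⟨hN1, hN2⟩ := floor_mul_natCast_bounds hβ0 r
  -- Up to rounding, `N + n/2 = 9r/8 + z/2`, just past the threshold for the character sum bound;
  -- `e` below then brings the total degree to `x - 2z`.
  obtain ⟨hn1, hn2⟩ := floor_mul_natCast_bounds
    (show 0 ≤ 1 / 4 + 2 * (1 - β) + s by linarith) r
  obtain ⟨he1, he2⟩ := floor_mul_natCast_bounds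
    (show 0 ≤ (α - 9 / 2 + 3 * β) / 2 - 2 * s by linarith) r
  obtain ⟨hD1, hD2⟩ := floor_mul_natCast_bounds (show 0 ≤ s / 4 by linarith) r
  have p1 : (1 / 4 + 2 * (1 - β) + s) * r = r / 4 + 2 * r - 2 * y + z := by rw [hy, hz]; ring
  have p2 : ((α - 9 / 2 + 3 * β) / 2 - 2 * s) * r = x / 2 - 9 / 4 * r + 3 / 2 * y - 2 * z := by
    rw [hx, hy, hz]; ring
  have p3 : s / 4 * r = z / 4 := by rw [hz]; ring
  generalize ⌊β * r⌋₊ = N at *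
  generalize ⌊(1 / 4 + 2 * (1 - β) + s) * r⌋₊ = n at *
  generalize ⌊((α - 9 / 2 + 3 * β) / 2 - 2 * s) * r⌋₊ = e at *
  generalize ⌊s / 4 * r⌋₊ = D₀ at *
  rw [p1] at hn1 hn2
  rw [p2] at he1 he2
  rw [p3] at hD1 hD2
  rw [← hy] at hN1 hN2
  have hDr : r + D₀ ≤ N + 2 * n + 2 * e := by
    have : (r : ℝ) + D₀ ≤ N + 2 * n + 2 * e := by linarith
    exact_mod_cast this
  obtain ⟨E, hE⟩ := Nat.exists_eq_add_of_le hDr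
  exact ⟨N, n, e, D₀, E, by exact_mod_cast hE, ⟨hN2, hN1⟩, ⟨hn2, hn1⟩, ⟨he2, he1⟩, hD2, hD1⟩

/-- In `hr2`, `2 ^ 32` dominates every constant such as `9 * 8 ^ 8 * 16`, and the 12 is the rounding
loss in `4n + 8N`. -/
theorem rpow_le_PsiSharp_of_factor_degrees {K : Type*} [Field K] [Fintype K] {F a : K[X]} {r : ℕ}
    (hF : Irreducible F) (hFr : F.natDegree = r) (ha : ¬ F ∣ a) {x y z k m : ℝ}
    (hr0 : (100 : ℝ) ≤ r) (hz100 : 100 ≤ z) (hxy : x ≤ 3 * y) (hy2 : y ≤ r)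
    (hzx : 8 * z ≤ x - 9 / 2 * r + 3 * y) (hzy : z ≤ y - 23 / 24 * r) (hk : x ≤ k) (hm : y ≤ m)
    (hr2 : (2 : ℝ) ^ 32 * r ^ 9 ≤ (Fintype.card K : ℝ) ^ (z / 4 - 12)) {N n e D₀ E : ℕ}
    (hE : (N : ℝ) + 2 * n + 2 * e = r + D₀ + E) (hN : y - 1 < N ∧ N ≤ y)
    (hn : r / 4 + 2 * r - 2 * y + z - 1 < n ∧ n ≤ r / 4 + 2 * r - 2 * y + z)
    (he : x / 2 - 9 / 4 * r + 3 / 2 * y - 2 * z - 1 < e ∧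
        e ≤ x / 2 - 9 / 4 * r + 3 / 2 * y - 2 * z)
    (hD : z / 4 - 1 < D₀ ∧ D₀ ≤ z / 4) :
    (Fintype.card K : ℝ) ^ (x - r - 8 * z) ≤ PsiSharp k m F a := by
  obtain ⟨hN1, hN2⟩ := hN
  obtain ⟨hn1, hn2⟩ := hn
  obtain ⟨he1, he2⟩ := he
  obtain ⟨hD1, hD2⟩ := hD
  have hq1 : (1 : ℝ) ≤ Fintype.card K := Nat.one_le_cast.2 Fintype.card_pos
  have hq0 : (0 : ℝ) < Fintype.card K := by linarith
  have hrpos : (0 : ℝ) < r := by linarith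
  have hr49 : (r : ℝ) ^ 4 ≤ r ^ 9 := pow_le_pow_right₀ (by linarith) (by norm_num)
  have hr89 : (r : ℝ) ^ 8 ≤ r ^ 9 := pow_le_pow_right₀ (by linarith) (by norm_num)
  have b1 : n ≠ 0 := by
    rintro rfl
    rw [Nat.cast_zero] at hn1
    linarith
  have b2 : e ≠ 0 := by
    rintro rfl
    rw [Nat.cast_zero] at he1
    linarith
  have b3 : 3 * n < F.natDegree := by
    rw [hFr]
    have : 3 * (n : ℝ) < r := by linarith
    exact_mod_cast this
  have b4 : e < F.natDegree := by
    rw [hFr]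
    have : (e : ℝ) < r := by linarith
    exact_mod_cast this
  have b5 : N ≤ F.natDegree := by
    rw [hFr]
    have : (N : ℝ) ≤ r := by linarith
    exact_mod_cast this
  have b6 : N + 2 * n + 2 * e = F.natDegree + D₀ + E := by
    rw [hFr]
    exact_mod_cast hE
  have b7 : D₀ ≤ n := by
    have : (D₀ : ℝ) ≤ n := by linarith
    exact_mod_cast this
  have b8 : D₀ ≤ e := by
    have : (D₀ : ℝ) ≤ e := by linarith
    exact_mod_cast this
  have b9 : 2 * D₀ ≤ N := by
    have : 2 * (D₀ : ℝ) ≤ N := by linarith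
    exact_mod_cast this
  have b10 : N ≤ 2 * E := by
    have : (N : ℝ) ≤ 2 * E := by linarith
    exact_mod_cast this
  have b11 : n ≤ E := by
    have : (n : ℝ) ≤ E := by linarith
    exact_mod_cast this
  have b12 : e ≤ E := by
    have : (e : ℝ) ≤ E := by linarith
    exact_mod_cast this
  have b13 : N + 2 * n + 2 * e ≤ 3 * F.natDegree := by
    rw [hFr]
    have : (N : ℝ) + 2 * n + 2 * e ≤ 3 * r := by linarith
    exact_mod_cast this
  have b14 : ((N + 2 * n + 2 * e : ℕ) : ℝ) ≤ k := by
    push_cast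
    linarith
  have b15 : 9 * 8 ^ 8 * 16 * (F.natDegree : ℝ) ^ 4 *
      (Fintype.card K : ℝ) ^ (8 * D₀ + 9 * F.natDegree) ≤
        (Fintype.card K : ℝ) ^ (4 * n + 8 * N) := by
    rw [hFr, ← Real.rpow_natCast _ (8 * D₀ + 9 * r), ← Real.rpow_natCast _ (4 * n + 8 * N)]
    have h1 : 9 * 8 ^ 8 * 16 * (r : ℝ) ^ 4 ≤ 2 ^ 32 * r ^ 9 := by
      have := pow_pos hrpos 4
      linarith
    refine (mul_le_mul_of_nonneg_right (h1.trans hr2) (by positivity)).trans ?_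
    rw [← Real.rpow_add hq0]
    refine Real.rpow_le_rpow_of_exponent_le hq1 ?_
    push_cast
    linarith
  have b16 : 3 ^ 5 * 256 * (F.natDegree : ℝ) ^ 9 ≤ (Fintype.card K : ℝ) ^ D₀ := by
    rw [hFr, ← Real.rpow_natCast _ D₀]
    have h1 : 3 ^ 5 * 256 * (r : ℝ) ^ 9 ≤ 2 ^ 32 * r ^ 9 := by
      have := pow_pos hrpos 9
      linarith
    exact (h1.trans hr2).trans (Real.rpow_le_rpow_of_exponent_le hq1 (by linarith))
  have key := pow_le_mul_PsiSharp hF ha b1 b2 b3 b4 b5 b6 b7 b8 b9 b10 b11 b12 b13 b14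
    (show (N : ℝ) ≤ m by linarith) (by linarith) (by linarith) b15 b16
  rw [hFr] at key
  have hpos : (0 : ℝ) < 256 * 81 * r ^ 8 := by positivity
  refine le_of_mul_le_mul_left (le_trans ?_ key) hpos
  have h1 : 256 * 81 * (r : ℝ) ^ 8 ≤ 2 ^ 32 * r ^ 9 := by
    have := pow_pos hrpos 8
    linarith
  rw [← Real.rpow_natCast _ (D₀ + E)]
  refine (mul_le_mul_of_nonneg_right (h1.trans hr2) (by positivity)).trans ?_
  rw [← Real.rpow_add hq0]
  refine Real.rpow_le_rpow_of_exponent_le hq1 ?_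
  push_cast
  linarith

/-- The main estimate for residue classes prime to the modulus. -/
theorem eventually_rpow_le_PsiSharp_of_not_dvd {K : Type*} [Field K] [Fintype K] {α β ε : ℝ}
    (hβ : β ∈ Set.Ioc (23 / 24 : ℝ) 1) (hα : α ∈ Set.Ioc (9 / 2 - 3 * β) (3 * β)) (hε : 0 < ε) :
    ∀ᶠ r : ℕ in atTop, ∀ k m : ℝ, (r : ℝ) * α ≤ k → (r : ℝ) * β ≤ m →
      ∀ F : K[X], Irreducible F → F.natDegree = r → ∀ a : K[X], ¬ F ∣ a →
        (Fintype.card K : ℝ) ^ ((α - 1 - ε) * r) ≤ PsiSharp k m F a := by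
  obtain ⟨hβ1, hβ2⟩ := hβ
  obtain ⟨hα1, hα2⟩ := hα
  -- The three bounds respectively keep `e` large, keep `n` below `r / 3`, and keep the loss `8 s r`
  -- in the exponent below `ε r`.
  obtain ⟨s, hs0, hs1, hs2, hs3⟩ : ∃ s : ℝ, 0 < s ∧ s ≤ (α - 9 / 2 + 3 * β) / 8 ∧
      s ≤ β - 23 / 24 ∧ s ≤ ε / 8 :=
    ⟨min ((α - 9 / 2 + 3 * β) / 8) (min (β - 23 / 24) (ε / 8)),
      lt_min (by linarith) (lt_min (by linarith) (by linarith)), min_le_left _ _,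
      (min_le_right _ _).trans (min_le_left _ _), (min_le_right _ _).trans (min_le_right _ _)⟩
  filter_upwards [eventually_const_mul_pow_le_two_rpow (c := s / 4) (by linarith) (2 ^ 32) 12 9,
    eventually_le_const_mul_nat hs0 100, eventually_ge_atTop 100] with r hr hsr hr100
  intro k m hk hm F hF hFr a ha
  have hr0 : (100 : ℝ) ≤ r := by exact_mod_cast hr100
  have hrn : (0 : ℝ) ≤ r := by linarith
  have hq2 : (2 : ℝ) ≤ Fintype.card K := by exact_mod_cast Fintype.one_lt_card
  have p1 := mul_le_mul_of_nonneg_right hβ2 hrn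
  have p2 := mul_le_mul_of_nonneg_right hs1 hrn
  have p3 := mul_le_mul_of_nonneg_right hs2 hrn
  have p4 := mul_le_mul_of_nonneg_right hα2 hrn
  have p5 := mul_le_mul_of_nonneg_right hs3 hrn
  have hy2 : β * r ≤ r := by linarith
  have hzx : 8 * (s * r) ≤ α * r - 9 / 2 * r + 3 * (β * r) := by linarith
  have hzy : s * r ≤ β * r - 23 / 24 * r := by linarith
  obtain ⟨N, n, e, D₀, E, hE, hN, hn, he, hD⟩ := exists_factor_degrees hβ2 hs0 hs1 (r := r)
    rfl rfl rfl hy2 hzx hzy hsr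
  have hr2 : (2 : ℝ) ^ 32 * r ^ 9 ≤ (Fintype.card K : ℝ) ^ (s * r / 4 - 12) := by
    rw [show s / 4 * r = s * r / 4 by ring] at hr
    exact hr.trans (Real.rpow_le_rpow (by norm_num) hq2 (by linarith))
  refine le_trans (Real.rpow_le_rpow_of_exponent_le (by linarith) ?_)
    (rpow_le_PsiSharp_of_factor_degrees hF hFr ha hr0 hsr (by linarith) hy2 hzx hzy
      (by linarith) (by linarith) hr2 hE hN hn he hD)
  linarith

/-! ### The zero residue class. -/

section ZeroResidueClass

variable {K : Type*} [Field K] [Fintype K]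

-- The products `F w w'` lie in the class. The unequal degrees `n` and `n + 1`, both below `deg F`,
-- make them square-free and the factorization unique, without ordering the pair.
open scoped Classical in
theorem card_mul_card_le_PsiSharp_of_dvd {F a : K[X]} (hFm : F.Monic) (hF : Irreducible F)
    (ha : F ∣ a) {n : ℕ} (hn : n + 1 < F.natDegree) {k m : ℝ}
    (hk : ((F.natDegree + 2 * n + 2 : ℕ) : ℝ) ≤ k) (hm : (F.natDegree : ℝ) ≤ m) :
    (monicIrreducibles K n).card * (monicIrreducibles K (n + 1)).card ≤ PsiSharp k m F a := by
  rw [PsiSharp, ← Finset.card_product, ← Set.ncard_coe_finset]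
  refine Set.ncard_le_ncard_of_injOn (fun w => F * (w.1 * w.2)) ?_ ?_ (smoothSqfreeSet_finite k m F a)
  · rintro ⟨w, w'⟩ hw
    rw [Finset.mem_coe, Finset.mem_product, mem_monicIrreducibles, mem_monicIrreducibles] at hw
    obtain ⟨⟨hwm, hwi, hwd⟩, hwm', hwi', hwd'⟩ := hw
    simp only at hwm hwi hwd hwm' hwi' hwd'
    have c1 : IsCoprime w w' := isCoprime_of_monic_irreducible_ne hwm hwi hwm' hwi' (by
      rintro rfl
      omega)
    have c2 : IsCoprime F w := isCoprime_of_monic_irreducible_ne hFm hF hwm hwi (by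
      rintro rfl
      omega)
    have c3 : IsCoprime F w' := isCoprime_of_monic_irreducible_ne hFm hF hwm' hwi' (by
      rintro rfl
      omega)
    refine ⟨(dvd_mul_right _ _).sub ha, ?_, fun p hp hd => ?_, ?_⟩
    · refine lt_of_lt_of_le (Nat.cast_lt.2 ?_) hk
      rw [natDegree_mul hF.ne_zero (mul_ne_zero hwi.ne_zero hwi'.ne_zero),
        natDegree_mul hwi.ne_zero hwi'.ne_zero]
      omega
    · refine le_trans (Nat.cast_le.2 ?_) hm
      rcases hp.prime.dvd_or_dvd hd with h | h
      · exact natDegree_le_of_dvd h hF.ne_zero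
      rcases hp.prime.dvd_or_dvd h with h | h
      · have : p.natDegree ≤ w.natDegree := natDegree_le_of_dvd h hwi.ne_zero
        omega
      · have : p.natDegree ≤ w'.natDegree := natDegree_le_of_dvd h hwi'.ne_zero
        omega
    · exact squarefree_mul_iff.2 ⟨(c2.mul_right c3).isRelPrime, hF.squarefree,
        squarefree_mul_iff.2 ⟨c1.isRelPrime, hwi.squarefree, hwi'.squarefree⟩⟩
  · rintro ⟨w, w'⟩ hw ⟨v, v'⟩ hv h
    rw [Finset.mem_coe, Finset.mem_product, mem_monicIrreducibles, mem_monicIrreducibles] at hw hv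
    obtain ⟨⟨hwm, hwi, hwd⟩, hwm', hwi', hwd'⟩ := hw
    obtain ⟨⟨hvm, hvi, hvd⟩, hvm', hvi', hvd'⟩ := hv
    simp only at hwm hwi hwd hwm' hwi' hwd' hvm hvi hvd hvm' hvi' hvd' h
    have h1 : w * w' = v * v' := mul_left_cancel₀ hF.ne_zero h
    have h2 : w = v := by
      rcases hwi.prime.dvd_or_dvd (h1 ▸ dvd_mul_right w w') with h3 | h3
      · exact eq_of_dvd_of_monic_irreducible hwm hwi hvm hvi h3
      · have h4 := eq_of_dvd_of_monic_irreducible hwm hwi hvm' hvi' h3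
        rw [h4] at hwd
        omega
    subst h2
    rw [mul_left_cancel₀ hwi.ne_zero h1]

theorem eventually_rpow_le_PsiSharp_of_dvd {α ε : ℝ} (hα : α ∈ Set.Ioc (3 / 2 : ℝ) 3)
    (hε : 0 < ε) :
    ∀ᶠ r : ℕ in atTop, ∀ k m : ℝ, (r : ℝ) * α ≤ k → (r : ℝ) ≤ m →
      ∀ F : K[X], F.Monic → Irreducible F → F.natDegree = r → ∀ a : K[X], F ∣ a →
        (Fintype.card K : ℝ) ^ ((α - 1 - ε) * r) ≤ PsiSharp k m F a := by
  obtain ⟨hα1, hα2⟩ := hα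
  obtain ⟨s, hs0, hs1, hs2⟩ : ∃ s : ℝ, 0 < s ∧ s ≤ ε / 2 ∧ s ≤ 1 / 4 :=
    ⟨min (ε / 2) (1 / 4), lt_min (by linarith) (by norm_num), min_le_left _ _, min_le_right _ _⟩
  filter_upwards [eventually_const_mul_pow_le_two_rpow hs0 4 1 2,
    eventually_le_const_mul_nat hs0 4, eventually_ge_atTop 100] with r hr hsr hr100
  intro k m hk hm F hFm hF hFr a ha
  have hr0 : (100 : ℝ) ≤ r := by exact_mod_cast hr100
  have hrn : (0 : ℝ) ≤ r := by linarith
  have hq2 : (2 : ℝ) ≤ Fintype.card K := by exact_mod_cast Fintype.one_lt_card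
  have hq0 : (0 : ℝ) < Fintype.card K := by linarith
  have p1 := mul_le_mul_of_nonneg_right hs1 hrn
  have p2 := mul_le_mul_of_nonneg_right hs2 hrn
  have p3 := mul_le_mul_of_nonneg_right hα2 hrn
  have p4 := mul_le_mul_of_nonneg_right hα1.le hrn
  -- The saving `s r ≥ 4` covers the `+ 2` in the degree condition; `2s ≤ ε` pays for it and for the
  -- factor `4 r ^ 2`.
  obtain ⟨hn1, hn2⟩ := floor_mul_natCast_bounds (show 0 ≤ (α - 1 - s) / 2 by linarith) r
  generalize ⌊(α - 1 - s) / 2 * r⌋₊ = n at hn1 hn2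
  rw [show (α - 1 - s) / 2 * r = (α * r - r - s * r) / 2 by ring] at hn1 hn2
  have hnr : n + 1 < r := by
    have : (n : ℝ) + 1 < r := by linarith
    exact_mod_cast this
  have hn0 : n ≠ 0 := by
    rintro rfl
    rw [Nat.cast_zero] at hn2
    linarith
  have hcard := card_mul_card_le_PsiSharp_of_dvd (k := k) (m := m) hFm hF ha (n := n) (by omega)
    (by rw [hFr]; push_cast; linarith) (by rw [hFr]; exact hm)
  have hX1 := pow_le_two_mul_mul_card_monicIrreducibles (K := K) hn0 (r := r) (by omega)
  have hX2 := pow_le_two_mul_mul_card_monicIrreducibles (K := K) n.succ_ne_zero (r := r) (by omega)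
  have hcard' : ((monicIrreducibles K n).card : ℝ) * (monicIrreducibles K (n + 1)).card ≤
      PsiSharp k m F a := by exact_mod_cast hcard
  have hpos : (0 : ℝ) < 4 * r ^ 2 := by positivity
  refine le_of_mul_le_mul_left ?_ hpos
  have h1 : 4 * (r : ℝ) ^ 2 ≤ (Fintype.card K : ℝ) ^ (s * r - 1) :=
    hr.trans (Real.rpow_le_rpow (by norm_num) hq2 (by linarith))
  calc 4 * (r : ℝ) ^ 2 * (Fintype.card K : ℝ) ^ ((α - 1 - ε) * r)
      ≤ (Fintype.card K : ℝ) ^ (s * r - 1) * (Fintype.card K : ℝ) ^ ((α - 1 - ε) * r) := by gcongr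
    _ = (Fintype.card K : ℝ) ^ (s * r - 1 + (α - 1 - ε) * r) := (Real.rpow_add hq0 _ _).symm
    _ ≤ (Fintype.card K : ℝ) ^ ((n + (n + 1) : ℕ) : ℝ) := by
        refine Real.rpow_le_rpow_of_exponent_le (by linarith) ?_
        push_cast
        linarith
    _ = (Fintype.card K : ℝ) ^ n * (Fintype.card K : ℝ) ^ (n + 1) := by
        rw [Real.rpow_natCast, pow_add]
    _ ≤ (2 * r * (monicIrreducibles K n).card) * (2 * r * (monicIrreducibles K (n + 1)).card) := by
        gcongr
    _ = 4 * (r : ℝ) ^ 2 * ((monicIrreducibles K n).card * (monicIrreducibles K (n + 1)).card) := by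
        ring
    _ ≤ _ := by gcongr

end ZeroResidueClass

/-! ### Diagonal choice of the error function and conclusion. -/

/-- If a monotone family of properties holds eventually for each fixed `ε > 0`, then it holds
eventually along some sequence `ε r` that tends to `0`. -/
theorem exists_tendsto_zero_eventually {P : ℕ → ℝ → Prop}
    (hmono : ∀ r ε ε', ε ≤ ε' → P r ε → P r ε') (hP : ∀ ε > 0, ∀ᶠ r in atTop, P r ε) :
    ∃ δ : ℕ → ℝ, Tendsto δ atTop (𝓝 0) ∧ ∀ᶠ r in atTop, P r (δ r) := by
  set A : ℕ → Set ℝ := fun r => {ε | 0 < ε ∧ P r ε}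
  have hbdd : ∀ r, BddBelow (A r) := fun r => ⟨0, fun ε hε => hε.1.le⟩
  have hinf : Tendsto (fun r => sInf (A r)) atTop (𝓝 0) := by
    refine Metric.tendsto_atTop'.2 fun ε hε => ?_
    obtain ⟨R, hR⟩ := eventually_atTop.1 (hP (ε / 2) (half_pos hε))
    refine ⟨R, fun r hr => ?_⟩
    have h1 : sInf (A r) ≤ ε / 2 := csInf_le (hbdd r) ⟨half_pos hε, hR r hr.le⟩
    have h2 : 0 ≤ sInf (A r) := Real.sInf_nonneg fun x hx => hx.1.le
    rw [Real.dist_eq, sub_zero, abs_of_nonneg h2]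
    linarith
  -- The infimum need not be attained; a vanishing positive shift puts an admissible `ε` below it.
  -- When `A r` is empty the infimum is 0 by convention, which happens for finitely many `r` only.
  refine ⟨fun r => sInf (A r) + 1 / ((r : ℝ) + 1), ?_, ?_⟩
  · simpa using hinf.add tendsto_one_div_add_atTop_nhds_zero_nat
  · filter_upwards [hP 1 one_pos] with r hr
    have hpos : (0 : ℝ) < 1 / ((r : ℝ) + 1) := by positivity
    obtain ⟨x, hx, hlt⟩ := exists_lt_of_csInf_lt (s := A r) ⟨1, one_pos, hr⟩
      (lt_add_of_pos_right _ hpos)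
    exact hmono r x _ hlt.le hx.2

theorem theorem2p6 {K : Type*} [Field K] [Fintype K] (α β : ℝ)
    (hβ : β ∈ Set.Ioc (23 / 24 : ℝ) 1) (hα : α ∈ Set.Ioc (9 / 2 - 3 * β) (3 * β))
    (η₁ η₂ : ℕ → ℝ) (hη₁ : Tendsto η₁ atTop (𝓝 0)) (hη₂ : Tendsto η₂ atTop (𝓝 0)) :
    ∃ e : ℕ → ℝ, Tendsto e atTop (𝓝 0) ∧
      ∀ᶠ r : ℕ in atTop, ∀ k m : ℝ,
        (r : ℝ) * α ≤ k → k ≤ (r : ℝ) * (α + η₁ r) →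
        (r : ℝ) * β ≤ m → m ≤ (r : ℝ) * (β + η₂ r) →
        ∀ F : K[X], F.Monic → Irreducible F → F.natDegree = r →
        ∀ a : K[X], (β < 1 → ¬ F ∣ a) →
          (Fintype.card K : ℝ) ^ (k - (r : ℝ) + e r * (r : ℝ)) ≤ (PsiSharp k m F a : ℝ) := by

  have hq1 : (1 : ℝ) ≤ Fintype.card K := Nat.one_le_cast.2 Fintype.card_pos
  obtain ⟨δ, hδ, hP⟩ := exists_tendsto_zero_eventually
    (P := fun r ε => ∀ k m : ℝ, (r : ℝ) * α ≤ k → (r : ℝ) * β ≤ m →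
      ∀ F : K[X], F.Monic → Irreducible F → F.natDegree = r → ∀ a : K[X], (β < 1 → ¬ F ∣ a) →
        (Fintype.card K : ℝ) ^ ((α - 1 - ε) * r) ≤ PsiSharp k m F a)
    (fun r ε ε' hε h k m hk hm F hFm hF hFr a ha =>
      (Real.rpow_le_rpow_of_exponent_le hq1
        (mul_le_mul_of_nonneg_right (by linarith) (Nat.cast_nonneg r))).trans
        (h k m hk hm F hFm hF hFr a ha))
    (fun ε hε => by
      have h1 := eventually_rpow_le_PsiSharp_of_not_dvd (K := K) hβ hα hε
      rcases hβ.2.lt_or_eq with hβ1 | rfl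
      · filter_upwards [h1] with r hr k m hk hm F hFm hF hFr a ha
        exact hr k m hk hm F hF hFr a (ha hβ1)
      · have h2 := eventually_rpow_le_PsiSharp_of_dvd (K := K) (α := α)
          ⟨by linarith [hα.1], by linarith [hα.2]⟩ hε
        filter_upwards [h1, h2] with r hr1 hr2 k m hk hm F hFm hF hFr a _
        by_cases ha : F ∣ a
        · exact hr2 k m hk (by linarith) F hFm hF hFr a ha
        · exact hr1 k m hk hm F hF hFr a ha)
  -- The term `η₁` compensates for `k` exceeding `α r`, since the estimate is stated with exponent
  -- `(α - 1 - δ r) r`.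
  refine ⟨fun r => -δ r - η₁ r, by simpa using hδ.neg.sub hη₁, ?_⟩
  filter_upwards [hP] with r hr k m hk hk' hm _ F hFm hF hFr a ha
  refine (Real.rpow_le_rpow_of_exponent_le hq1 ?_).trans (hr k m hk hm F hFm hF hFr a ha)
  linarith
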